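/- Let $A$ be a finite alphabet and let $\gamma_a\in(0,1)$, $a\in A$, be such that $\sum_{a\in A} n_a\gamma_a\neq 1$ for all $(n_a)_{a\in A}\in\{0,1,2,\dots\}^A$. For a word $v=a_1\cdots a_k$ in $A$ put $|v|_\gamma=\gamma_{a_1}+\dots+\gamma_{a_k}$ and $\ell(v)=k$. Let $\mathcal H_{\mathrm a}$ be the span of the finitely many words with $|v|_\gamma\le 1$, and let $\mathcal H_{\mathrm a}^*$ be its dual, with the convolution product $\star$ dual to deconcatenation and with unit $\varepsilon$ (the counit). Let $\mathfrak g_{\mathrm a}\subset\mathcal H_{\mathrm a}^*$ be the set of $\alpha$ such that $\langle\alpha,u\mathbin{\sqcup\!\sqcup}v\rangle=\langle\alpha,u\rangle\langle\varepsilon,v\rangle+\langle\varepsilon,u\rangle\langle\alpha,v\rangle$ for all words $u,v$ with $|uv|_\gamma\le1$ (where $\sqcup\!\sqcup$ is the shuffle product), and let $G_{\mathrm a}=\exp_\star(\mathfrak g_{\mathrm a})$. An anisotropic geometric $\gamma$-rough path is a map $X:[0,1]^2\to G_{\mathrm a}$ with $X_{tt}=\varepsilon$, with $X_{su}\star X_{ut}=X_{st}$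 for all $s,u,t\in[0,1]$, and such that for every word $v$ with $|v|_\gamma\le1$ there is a constant $C$ with $|\langle X_{st},v\rangle|\le C|t-s|^{|v|_\gamma}$ for all $s,t\in[0,1]$. It is over the family of paths $x=(x^a)_{a\in A}$, $x^a:[0,1]\to\mathbb R$, if $\langle X_{st},a\rangle=x^a_t-x^a_s$ for all $a,s,t$. Call it dyadically normalized if, for every word $v$ with $\ell(v)\ge2$ and $|v|_\gamma\le1$, one has $\langle\log_\star X_{0,1},v\rangle=0$, and $\langle\log_\star X_{su},v\rangle=\langle\log_\star X_{ut},v\rangle$ for each dyadic interval $[s,t]=[k2^{-m},(k+1)2^{-m}]\subset[0,1]$ with midpoint $u$. Then the following hold. 1. For every family $x=(x^a)_{a\in A}$ with $x^a$ $\gamma_a$-Hölder on $[0,1]$, there exists an anisotropic geometric $\gamma$-rough path over $x$. Moreover, there is exactly one which is dyadically normalized; denote it by $\Phi(x)$. 2. For an anisotropic geometric $\gamma$-rough path $X$ and a family $g=(g^a)_{a\in A}$ with $g^a$ $\gamma_a$-Hölder, let $gX=\Phi\big((\langle X_{0\,\cdot},a\rangle+g^a)_{a\in A}\big)$. If $X$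 is over a family $x$ of $\gamma_a$-Hölder paths, then $gX=\Phi(x+g)$; in particular $gX$ is an anisotropic geometric $\gamma$-rough path over $x+g$. For any two such families $g,g'$ and every $X$, $$g'(gX)=(g+g')X .$$ -/

import Mathlib

open scoped BigOperators unitInterval

noncomputable section

namespace AnisoRP

/-- The shuffle product of two words, as the list (with multiplicity) of its words:
`1 ⧢ v = v`, `u ⧢ 1 = u`, `(a u) ⧢ (b v) = a (u ⧢ b v) + b (a u ⧢ v)`. -/
def shuffle {A : Type*} : List A → List A → List (List A)
  | [], v => [v]
  | a :: u, [] => [a :: u]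
  | a :: u, b :: v =>
      (shuffle u (b :: v)).map (fun w => a :: w) ++ (shuffle (a :: u) v).map (fun w => b :: w)
  termination_by u v => u.length + v.length

/-- `γ_{a₁} + ⋯ + γ_{aₖ}` for the word `a₁ ⋯ aₖ`. This is `(min γ) * ω(v)`, where `ω` is the usual
normalised weight; so the truncation `ω(v) ≤ (min γ)⁻¹` reads `weight γ v ≤ 1`. -/
def weight {A : Type*} (γ : A → ℝ) (v : List A) : ℝ := (v.map γ).sum

/-- The words that span the truncated coalgebra `H_a`. -/
def admissible {A : Type*} (γ : A → ℝ) : Set (List A) := {v | weight γ v ≤ 1}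

/-- A linear functional on the span of words is given by its values on words. Elements of the
dual of `H_a` are the functionals that vanish on the words outside `admissible γ`. -/
abbrev Functional (A : Type*) := List A → ℝ

/-- The counit, which is the unit of the convolution product. -/
def counit (A : Type*) : Functional A
  | [] => 1
  | _ :: _ => 0

/-- The convolution product on the dual of `H_a`, dual to deconcatenation of words. -/
def conv {A : Type*} (γ : A → ℝ) (X Y : Functional A) : Functional A :=
  (admissible γ).indicator fun v =>
    ∑ i ∈ Finset.range (v.length + 1), X (v.take i) * Y (v.drop i)

/-- Convolution powers. -/
def convPow {A : Type*} (γ : A → ℝ) (X : Functional A) : ℕ → Functional A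
  | 0 => counit A
  | n + 1 => conv γ X (convPow γ X n)

/-- `exp α = ∑ α^{⋆k} / k!` for `α` with `α 1 = 0`; on a word `v` the terms with `k > ℓ(v)`
vanish. -/
def expo {A : Type*} (γ : A → ℝ) (α : Functional A) : Functional A := fun v =>
  ∑ k ∈ Finset.range (v.length + 1), convPow γ α k v / (k.factorial : ℝ)

/-- `log X = ∑_{k ≥ 1} (-1)^{k+1} (X - ε)^{⋆k} / k` for `X` with `X 1 = 1`; on a word `v` the terms
with `k > ℓ(v)` vanish. -/
def logo {A : Type*} (γ : A → ℝ) (X : Functional A) : Functional A := fun v =>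
  ∑ k ∈ Finset.Icc 1 v.length,
    (-1 : ℝ) ^ (k + 1) * convPow γ (fun w => X w - counit A w) k v / (k : ℝ)

/-- Infinitesimal characters on `H_a`:
`α(u ⧢ v) = α(u) ε(v) + ε(u) α(v)` whenever the product `u ⧢ v` lies in `H_a`
(all the words of `u ⧢ v` have the weight of the word `u v`). -/
def lieAlg {A : Type*} (γ : A → ℝ) : Set (Functional A) :=
  {α | (∀ v, v ∉ admissible γ → α v = 0) ∧
    ∀ u v : List A, u ++ v ∈ admissible γ →
      ((shuffle u v).map α).sum = α u * counit A v + counit A u * α v}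

/-- The group `G_a = exp(g_a)`. -/
def group {A : Type*} (γ : A → ℝ) : Set (Functional A) := expo γ '' lieAlg γ

/-- Anisotropic geometric `γ`-rough paths. -/
structure IsAGRP {A : Type*} (γ : A → ℝ) (X : I → I → Functional A) : Prop where
  mem_group : ∀ s t, X s t ∈ group γ
  diag : ∀ t, X t t = counit A
  chen : ∀ s u t, conv γ (X s u) (X u t) = X s t
  bound : ∀ v ∈ admissible γ, ∃ C : ℝ, ∀ s t : I,
    |X s t v| ≤ C * |(t : ℝ) - (s : ℝ)| ^ weight γ v

/-- `X` is a lift of the family of paths `x`. -/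
def IsOver {A : Type*} (X : I → I → Functional A) (x : A → I → ℝ) : Prop :=
  ∀ a s t, X s t [a] = x a t - x a s

/-- `x^a` is `γ_a`-Hölder for every letter `a`. -/
def IsHolderFamily {A : Type*} (γ : A → ℝ) (x : A → I → ℝ) : Prop :=
  ∀ a, MemHolder (γ a).toNNReal (x a)

/-- The choices that determine the construction: on words of length at least two,
`log X` vanishes on the whole interval `[0, 1]`, and takes equal values
on the two halves of each dyadic interval. -/
structure IsDyadicallyNormalized {A : Type*} (γ : A → ℝ) (X : I → I → Functional A) : Prop where
  whole : ∀ v ∈ admissible γ, 2 ≤ v.length → logo γ (X 0 1) v = 0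
  halves : ∀ v ∈ admissible γ, 2 ≤ v.length → ∀ (m k : ℕ) (s u t : I),
    (s : ℝ) = k / 2 ^ m → (u : ℝ) = (2 * k + 1) / 2 ^ (m + 1) → (t : ℝ) = (k + 1) / 2 ^ m →
    logo γ (X s u) v = logo γ (X u t) v

/-- The paths `x^a_t = ⟨X_{0t}, a⟩` under `X`. -/
def trace {A : Type*} (X : I → I → Functional A) : A → I → ℝ := fun a t => X 0 t [a]

/-- `gX`: the rough path that the construction `Φ` puts over the paths of `X` perturbed by `g`. -/
def translate {A : Type*} (Φ : (A → I → ℝ) → I → I → Functional A) (g : A → I → ℝ)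
    (X : I → I → Functional A) : I → I → Functional A := Φ (trace X + g)

end AnisoRP

end

/-! The lift is built by induction on word length. Suppose `X` is known on words of length at most
`n` and is zero on longer ones, and let `v` be an admissible word of length `n + 1`. For any
function `F`, putting `F t - F s - (X 0 s * X s t) v` at `v` makes Chen's relation hold there: this
is associativity (`IsPartialLift.cocycle`). The logarithm is affine in the top level
(`Ser.log_add_apply`), so the new value of the logarithm at `v` is `F t - F s - b s t`, where `b s t
= (X 0 s * X s t) v - (X s t).log v`. This `b` is additive up to an error of order `β = weight γ v`,
and non-resonance gives `β < 1`.

For `β < 1` a path `F` with increments within order `β` of `b` exists but is not unique. Requiring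
equal errors on the two halves of each dyadic interval, and no error on `[0, 1]`, fixes one: the
errors are halved at each refinement, up to a term of order `2 ^ (-nβ)`, and this recursion stays
bounded at that order exactly because `2 * (1 / 2) ^ β > 1` (`exists_dyadic_path`).

Rigidity comes from `eq_zero_of_additive_of_dyadic`: an additive function of Hölder order `β > 0`
that vanishes on `[0, 1]` and agrees on dyadic halves is zero. It is used twice. Once shorter words
are settled, the failure of the shuffle identity is additive in `(s, t)` (`Ser.defect_mul`) and
equals the value of the logarithm on the shuffle (`Ser.sh_log`), so it inherits the normalization
and vanishes. Likewise the difference of two normalized lifts that agree on shorter words is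
additive and normalized, which gives uniqueness.

By uniqueness `Φ x` depends only on the increments of `x`, and the translation identities follow by
comparing increments. -/

noncomputable section

namespace AnisoRP

variable {A : Type*}

/-! ### Noncommutative series, their powers and logarithm -/

/-- Noncommutative formal power series: functionals on words, multiplied by deconcatenation. -/
def Ser (A : Type*) := List A → ℝ

namespace Ser

instance : AddCommGroup (Ser A) := inferInstanceAs (AddCommGroup (List A → ℝ))

instance : Module ℝ (Ser A) := inferInstanceAs (Module ℝ (List A → ℝ))

instance : One (Ser A) := ⟨counit A⟩

instance : Mul (Ser A) :=
  ⟨fun X Y v => ∑ i ∈ Finset.range (v.length + 1), X (v.take i) * Y (v.drop i)⟩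

@[ext] theorem ext {X Y : Ser A} (h : ∀ v, X v = Y v) : X = Y := funext h

@[simp] theorem add_apply (X Y : Ser A) (v : List A) : (X + Y) v = X v + Y v := rfl

@[simp] theorem sub_apply (X Y : Ser A) (v : List A) : (X - Y) v = X v - Y v := rfl

@[simp] theorem zero_apply (v : List A) : (0 : Ser A) v = 0 := rfl

@[simp] theorem smul_apply (c : ℝ) (X : Ser A) (v : List A) : (c • X) v = c * X v := rfl

theorem mul_apply (X Y : Ser A) (v : List A) :
    (X * Y) v = ∑ i ∈ Finset.range (v.length + 1), X (v.take i) * Y (v.drop i) := rfl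

theorem one_apply (v : List A) : (1 : Ser A) v = counit A v := rfl

@[simp] theorem one_nil : (1 : Ser A) [] = 1 := rfl

@[simp] theorem one_cons (a : A) (v : List A) : (1 : Ser A) (a :: v) = 0 := rfl

theorem one_of_ne_nil {v : List A} (hv : v ≠ []) : (1 : Ser A) v = 0 := by
  cases v with
  | nil => exact absurd rfl hv
  | cons a v => rfl

@[simp] theorem mul_nil (X Y : Ser A) : (X * Y) [] = X [] * Y [] := by simp [mul_apply]

/-- The series `w ↦ X (a w)`. -/
def shift (a : A) (X : Ser A) : Ser A := fun w => X (a :: w)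

theorem shift_apply (a : A) (X : Ser A) (v : List A) : shift a X v = X (a :: v) := rfl

theorem mul_cons (X Y : Ser A) (a : A) (v : List A) :
    (X * Y) (a :: v) = X [] * Y (a :: v) + (shift a X * Y) v := by
  simp only [mul_apply, List.length_cons]
  rw [Finset.sum_range_succ']
  simp [add_comm, shift]

theorem shift_mul (a : A) (X Y : Ser A) :
    shift a (X * Y) = X [] • shift a Y + shift a X * Y := by
  ext v
  exact mul_cons X Y a v

protected theorem add_mul' (X Y Z : Ser A) : (X + Y) * Z = X * Z + Y * Z := by
  ext v
  simp [mul_apply, add_mul, Finset.sum_add_distrib]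

protected theorem mul_add' (X Y Z : Ser A) : X * (Y + Z) = X * Y + X * Z := by
  ext v
  simp [mul_apply, mul_add, Finset.sum_add_distrib]

protected theorem smul_mul' (c : ℝ) (X Y : Ser A) : (c • X) * Y = c • (X * Y) := by
  ext v
  simp [mul_apply, Finset.mul_sum, mul_assoc]

protected theorem mul_assoc' (X Y Z : Ser A) : X * Y * Z = X * (Y * Z) := by
  ext v
  induction v generalizing X Y with
  | nil => simp [mul_assoc]
  | cons a v ih =>
    rw [mul_cons, mul_cons, shift_mul, Ser.add_mul', Ser.smul_mul', mul_cons Y Z, add_apply, ih]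
    simp
    ring

protected theorem zero_mul' (X : Ser A) : 0 * X = 0 := by
  ext v; simp [mul_apply]

protected theorem mul_zero' (X : Ser A) : X * 0 = 0 := by
  ext v; simp [mul_apply]

protected theorem one_mul' (X : Ser A) : 1 * X = X := by
  ext v
  cases v with
  | nil => simp
  | cons a v =>
    have : shift a (1 : Ser A) = 0 := rfl
    rw [mul_cons, this, Ser.zero_mul']
    simp

protected theorem mul_one' (X : Ser A) : X * 1 = X := by
  ext v
  induction v generalizing X with
  | nil => simp
  | cons a v ih => rw [mul_cons, ih]; simp [shift]

instance : Ring (Ser A) :=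
  { (inferInstance : AddCommGroup (Ser A)), (inferInstance : One (Ser A)),
    (inferInstance : Mul (Ser A)) with
    left_distrib := Ser.mul_add'
    right_distrib := Ser.add_mul'
    zero_mul := Ser.zero_mul'
    mul_zero := Ser.mul_zero'
    mul_assoc := Ser.mul_assoc'
    one_mul := Ser.one_mul'
    mul_one := Ser.mul_one' }

theorem mul_apply_of_take_vanish {X : Ser A} {v : List A}
    (hX : ∀ i < v.length, X (v.take i) = 0) (Y : Ser A) : (X * Y) v = X v * Y [] := by
  rw [mul_apply, Finset.sum_eq_single v.length]
  · simp
  · intro i hi hne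
    have := Finset.mem_range.1 hi
    rw [hX i (by omega), zero_mul]
  · simp

theorem mul_apply_of_drop_vanish (X : Ser A) {Y : Ser A} {v : List A}
    (hY : ∀ i, 0 < i → i ≤ v.length → Y (v.drop i) = 0) : (X * Y) v = X [] * Y v := by
  rw [mul_apply, Finset.sum_eq_single 0]
  · simp
  · intro i hi hne
    have := Finset.mem_range.1 hi
    rw [hY i (by omega) (by omega), mul_zero]
  · simp

/-- If `X` vanishes on the words of length less than `n`, then only one term of
`X * Y` survives on the words of length at most `n`. -/
theorem mul_apply_of_left_vanish {n : ℕ} {X : Ser A} (hX : ∀ v, v.length < n → X v = 0)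
    (Y : Ser A) {v : List A} (hv : v.length ≤ n) : (X * Y) v = X v * Y [] :=
  mul_apply_of_take_vanish (fun i hi => hX _ (by rw [List.length_take]; omega)) Y

theorem mul_apply_of_right_vanish {n : ℕ} (X : Ser A) {Y : Ser A}
    (hY : ∀ v, v.length < n → Y v = 0) {v : List A} (hv : v.length ≤ n) :
    (X * Y) v = X [] * Y v :=
  mul_apply_of_drop_vanish X fun i h0 hi => hY _ (by rw [List.length_drop]; omega)

theorem mul_apply_congr {X X' Y Y' : Ser A} {v : List A}
    (hX : ∀ i, X (v.take i) = X' (v.take i)) (hY : ∀ i, Y (v.drop i) = Y' (v.drop i)) :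
    (X * Y) v = (X' * Y') v := by
  simp only [mul_apply, hX, hY]

theorem pow_apply_of_length_lt {X : Ser A} (hX : X [] = 0) (k : ℕ) {v : List A}
    (hv : v.length < k) : (X ^ k) v = 0 := by
  induction k generalizing v with
  | zero => simp at hv
  | succ k ih =>
    rw [pow_succ, mul_apply_of_left_vanish (n := k) (fun w hw => ih hw) X (by omega), hX, mul_zero]

/-- The perturbation of `X * Y` by terms of length at least `n`, seen on words of length
at most `n`. -/
theorem add_mul_add_apply {n : ℕ} (X Y : Ser A) {ρ τ : Ser A}
    (hρ : ∀ v, v.length < n → ρ v = 0) (hτ : ∀ v, v.length < n → τ v = 0) (hn : 0 < n)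
    {v : List A} (hv : v.length ≤ n) :
    ((X + ρ) * (Y + τ)) v = (X * Y) v + ρ v * Y [] + X [] * τ v := by
  rw [add_mul, mul_add, add_apply, add_apply, mul_apply_of_right_vanish X hτ hv,
    mul_apply_of_left_vanish hρ _ hv, add_apply, hτ [] (by simpa using hn)]
  ring

/-- The logarithm of a series with constant term `1`. -/
def log (X : Ser A) : Ser A := fun v =>
  ∑ k ∈ Finset.Icc 1 v.length, (-1 : ℝ) ^ (k + 1) * ((X - 1) ^ k) v / (k : ℝ)

/-- The exponential of a series without constant term. -/
def exp (X : Ser A) : Ser A := fun v =>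
  ∑ k ∈ Finset.range (v.length + 1), (X ^ k) v / (k.factorial : ℝ)

/-- A product of two or more factors, one of which is `τ`, starts in length above `n`, because `N`
has no constant term. Only the first power sees `τ`. -/
theorem pow_add_apply {n : ℕ} {N τ : Ser A} (hN : N [] = 0)
    (hτ : ∀ v, v.length < n → τ v = 0) (hn : 0 < n) (k : ℕ) {v : List A} (hv : v.length ≤ n) :
    ((N + τ) ^ (k + 1)) v = (N ^ (k + 1)) v + if k = 0 then τ v else 0 := by
  induction k generalizing v with
  | zero => simp
  | succ k ih =>
    rw [pow_succ', pow_succ' N]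
    have h0 : ∀ w : List A, w.length ≤ n → ((N + τ) ^ (k + 1)) w =
        (N ^ (k + 1) + (if k = 0 then τ else 0)) w := by
      intro w hw
      rw [ih hw, add_apply]
      split_ifs <;> simp
    rw [mul_apply_congr (X' := N + τ) (Y' := N ^ (k + 1) + if k = 0 then τ else 0)
      (fun _ => rfl) (fun i => h0 _ (by rw [List.length_drop]; omega)),
      add_mul_add_apply N _ hτ (n := n) _ hn hv, hN,
      pow_apply_of_length_lt hN (k + 1) (by simp)]
    · simp
    · intro w hw
      split_ifs
      · exact hτ w hw
      · rfl

/-- Only the linear term of the logarithm series feels a top-level perturbation. This turns a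
condition on the logarithm into a scalar condition on the new coefficient. -/
theorem log_add_apply {n : ℕ} {X τ : Ser A} (hX : X [] = 1)
    (hτ : ∀ v, v.length < n → τ v = 0) (hn : 0 < n) {v : List A} (hv : v.length ≤ n) :
    log (X + τ) v = log X v + τ v := by
  by_cases h0 : v = []
  · subst h0
    rw [hτ [] (by simpa using hn)]
    simp [log]
  have hl : 1 ≤ v.length := List.length_pos_iff.2 h0
  have key : ∀ k ∈ Finset.Icc 1 v.length,
      (-1 : ℝ) ^ (k + 1) * ((X + τ - 1) ^ k) v / (k : ℝ) =
        (-1 : ℝ) ^ (k + 1) * ((X - 1) ^ k) v / (k : ℝ) + if k = 1 then τ v else 0 := by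
    intro k hk
    obtain ⟨j, rfl⟩ : ∃ j, k = j + 1 := ⟨k - 1, by have := Finset.mem_Icc.1 hk; omega⟩
    rw [show X + τ - 1 = (X - 1) + τ by abel, pow_add_apply (by simp [hX]) hτ hn j hv]
    by_cases hj : j = 0
    · subst hj; simp
    · simp [hj]
  rw [log, Finset.sum_congr rfl key, Finset.sum_add_distrib, Finset.sum_ite_eq' _ 1, if_pos
    (Finset.mem_Icc.2 ⟨le_rfl, hl⟩), log]

theorem log_congr {n : ℕ} {X Y : Ser A} (hX : X [] = 1)
    (h : ∀ v, v.length < n → Y v = X v) (hn : 0 < n) {v : List A} (hv : v.length ≤ n) :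
    log Y v = log X v + (Y v - X v) := by
  have := log_add_apply (n := n) (τ := Y - X) hX (fun w hw => by simp [h w hw]) hn hv
  rwa [add_sub_cancel] at this

end Ser

/-! ### Admissible words: truncated convolution agrees with the series product -/

theorem weight_append (γ : A → ℝ) (u v : List A) :
    weight γ (u ++ v) = weight γ u + weight γ v := by simp [weight]

theorem weight_perm (γ : A → ℝ) {u v : List A} (h : u.Perm v) : weight γ u = weight γ v :=
  (h.map γ).sum_eq

theorem weight_nonneg {γ : A → ℝ} (hγ : ∀ a, 0 < γ a) (v : List A) : 0 ≤ weight γ v :=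
  List.sum_nonneg (by simp; intro a _; exact (hγ a).le)

theorem weight_pos {γ : A → ℝ} (hγ : ∀ a, 0 < γ a) {v : List A} (hv : v ≠ []) :
    0 < weight γ v := by
  obtain ⟨a, w, rfl⟩ := List.exists_cons_of_ne_nil hv
  have h1 := hγ a
  have h2 := weight_nonneg hγ w
  simp only [weight, List.map_cons, List.sum_cons] at h2 ⊢
  linarith

theorem weight_sublist {γ : A → ℝ} (hγ : ∀ a, 0 < γ a) {u v : List A} (h : u.Sublist v) :
    weight γ u ≤ weight γ v :=
  (h.map γ).sum_le_sum (by simp; intro a _; exact (hγ a).le)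

theorem admissible_of_sublist {γ : A → ℝ} (hγ : ∀ a, 0 < γ a) {u v : List A}
    (h : u.Sublist v) (hv : v ∈ admissible γ) : u ∈ admissible γ :=
  (weight_sublist hγ h).trans hv

theorem conv_apply {γ : A → ℝ} {v : List A} (hv : v ∈ admissible γ) (X Y : Ser A) :
    conv γ X Y v = (X * Y) v := Set.indicator_of_mem hv _

theorem convPow_apply {γ : A → ℝ} (hγ : ∀ a, 0 < γ a) (X : Ser A) (k : ℕ) {v : List A}
    (hv : v ∈ admissible γ) : convPow γ X k v = (X ^ k) v := by
  induction k generalizing v with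
  | zero => rfl
  | succ k ih =>
    rw [pow_succ']
    refine (conv_apply hv X (convPow γ X k : Ser A)).trans ?_
    exact Ser.mul_apply_congr (fun _ => rfl)
      fun i => ih (admissible_of_sublist hγ (List.drop_sublist i v) hv)

theorem logo_apply {γ : A → ℝ} (hγ : ∀ a, 0 < γ a) (X : Ser A) {v : List A}
    (hv : v ∈ admissible γ) : logo γ X v = Ser.log X v :=
  Finset.sum_congr rfl fun k _ => by
    rw [← convPow_apply hγ (X - 1) k hv]; rfl

theorem expo_apply {γ : A → ℝ} (hγ : ∀ a, 0 < γ a) (X : Ser A) {v : List A}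
    (hv : v ∈ admissible γ) : expo γ X v = Ser.exp X v :=
  Finset.sum_congr rfl fun k _ => by rw [← convPow_apply hγ X k hv]

theorem convPow_of_not_admissible {γ : A → ℝ} (X : Functional A) (k : ℕ) {v : List A}
    (hv : v ∉ admissible γ) : convPow γ X k v = 0 := by
  cases k with
  | zero =>
    cases v with
    | nil => exact absurd (by simp [admissible, weight]) hv
    | cons a v => rfl
  | succ k =>
    rw [convPow.eq_def]
    exact Set.indicator_of_notMem hv _

theorem expo_of_not_admissible {γ : A → ℝ} (X : Functional A) {v : List A}
    (hv : v ∉ admissible γ) : expo γ X v = 0 :=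
  Finset.sum_eq_zero fun k _ => by rw [convPow_of_not_admissible X k hv, zero_div]

theorem perm_of_mem_shuffle {u v w : List A} (h : w ∈ shuffle u v) : w.Perm (u ++ v) := by
  fun_induction shuffle u v generalizing w with
  | case1 v => simp_all
  | case2 a u => simp_all
  | case3 a u b v ih1 ih2 =>
    rw [List.mem_append, List.mem_map, List.mem_map] at h
    rcases h with ⟨w', hw', rfl⟩ | ⟨w', hw', rfl⟩
    · exact (ih1 hw').cons a
    · exact ((ih2 hw').cons b).trans List.perm_middle.symm

/-! ### Shuffle products, multiplicativity defects, and the logarithm -/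

namespace Ser

/-- The value of `X` on the shuffle product of two words. -/
def sh (X : Ser A) (u v : List A) : ℝ := ((shuffle u v).map fun w => X w).sum

@[simp] theorem sh_nil_left (X : Ser A) (v : List A) : sh X [] v = X v := by simp [sh, shuffle]

@[simp] theorem sh_nil_right (X : Ser A) (u : List A) : sh X u [] = X u := by
  cases u <;> simp [sh, shuffle]

theorem sh_cons_cons (X : Ser A) (a b : A) (u v : List A) :
    sh X (a :: u) (b :: v) = sh (shift a X) u (b :: v) + sh (shift b X) (a :: u) v := by
  rw [sh, shuffle, List.map_append, List.sum_append, List.map_map, List.map_map]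
  rfl

theorem sh_add (X Y : Ser A) (u v : List A) : sh (X + Y) u v = sh X u v + sh Y u v :=
  List.sum_map_add

theorem sh_smul (c : ℝ) (X : Ser A) (u v : List A) : sh (c • X) u v = c * sh X u v :=
  List.sum_map_mul_left (shuffle u v) (fun w => X w) c

theorem sh_congr {X Y : Ser A} {u v : List A} (h : ∀ w, w.Perm (u ++ v) → X w = Y w) :
    sh X u v = sh Y u v :=
  congrArg List.sum (List.map_congr_left fun w hw => h w (perm_of_mem_shuffle hw))

/-- The convolution of functionals on pairs of words. -/
def conv2 (F G : List A → List A → ℝ) (u v : List A) : ℝ :=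
  ∑ i ∈ Finset.range (u.length + 1), ∑ j ∈ Finset.range (v.length + 1),
    F (u.take i) (v.take j) * G (u.drop i) (v.drop j)

/-- This is the compatibility of shuffle with deconcatenation (the bialgebra axiom) in dual form.
Induction on total length, removing the first letter of either word. -/
theorem sh_mul (X Y : Ser A) (u v : List A) : sh (X * Y) u v = conv2 (sh X) (sh Y) u v := by
  induction hn : u.length + v.length using Nat.strong_induction_on generalizing X u v with
  | _ n ih =>
  cases u with
  | nil => simp [conv2, mul_apply]
  | cons a u =>
  cases v with
  | nil => simp [conv2, mul_apply]
  | cons b v =>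
    simp only [List.length_cons] at hn
    rw [sh_cons_cons, shift_mul, shift_mul, sh_add, sh_add, sh_smul, sh_smul,
      ih _ (by simp only [List.length_cons]; omega) (shift a X) u (b :: v) rfl,
      ih _ (by simp only [List.length_cons]; omega) (shift b X) (a :: u) v rfl]
    simp only [conv2, List.length_cons]
    rw [Finset.sum_range_succ' _ (u.length + 1), Finset.sum_range_succ' _ (u.length + 1)]
    simp only [Finset.sum_range_succ' _ (v.length + 1), List.take_succ_cons, List.drop_succ_cons,
      List.take_zero, List.drop_zero, sh_cons_cons, sh_nil_left, sh_nil_right, add_mul,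
      Finset.sum_add_distrib, shift_apply, mul_add]
    ring

/-- The failure of multiplicativity of `X` on the shuffle product of two words. -/
def defect (X : Ser A) (u v : List A) : ℝ := sh X u v - X u * X v

theorem defect_nil_left {X : Ser A} (hX : X [] = 1) (v : List A) : defect X [] v = 0 := by
  simp [defect, hX]

theorem defect_nil_right {X : Ser A} (hX : X [] = 1) (u : List A) : defect X u [] = 0 := by
  simp [defect, hX]

theorem conv2_mul (X Y : Ser A) (u v : List A) :
    conv2 (fun u v => X u * X v) (fun u v => Y u * Y v) u v = (X * Y) u * (X * Y) v := by
  rw [conv2, mul_apply, mul_apply, Finset.sum_mul_sum]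
  exact Finset.sum_congr rfl fun i _ => Finset.sum_congr rfl fun j _ => by ring

theorem conv2_of_left_vanish {E : List A → List A → ℝ} (G : List A → List A → ℝ) {u v : List A}
    (hE : ∀ i j, (u.take i).length + (v.take j).length < u.length + v.length →
      E (u.take i) (v.take j) = 0) :
    conv2 E G u v = E u v * G [] [] := by
  rw [conv2, Finset.sum_eq_single u.length, Finset.sum_eq_single v.length]
  · simp
  · intro j hj hne
    have := Finset.mem_range.1 hj
    rw [hE, zero_mul]
    simp only [List.length_take]
    omega
  · simp
  · intro i hi hne
    have := Finset.mem_range.1 hi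
    refine Finset.sum_eq_zero fun j _ => ?_
    rw [hE, zero_mul]
    simp only [List.length_take]
    omega
  · simp

theorem conv2_of_right_vanish (F : List A → List A → ℝ) {E : List A → List A → ℝ} {u v : List A}
    (hE : ∀ i j, (u.drop i).length + (v.drop j).length < u.length + v.length →
      E (u.drop i) (v.drop j) = 0) :
    conv2 F E u v = F [] [] * E u v := by
  rw [conv2, Finset.sum_eq_single 0, Finset.sum_eq_single 0]
  · simp
  · intro j hj hne
    have := Finset.mem_range.1 hj
    rw [hE, mul_zero]
    simp only [List.length_drop]
    omega
  · simp
  · intro i hi hne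
    have := Finset.mem_range.1 hi
    refine Finset.sum_eq_zero fun j _ => ?_
    rw [hE, mul_zero]
    simp only [List.length_drop]
    omega
  · simp

theorem conv2_add_left (F F' G : List A → List A → ℝ) (u v : List A) :
    conv2 (F + F') G u v = conv2 F G u v + conv2 F' G u v := by
  simp [conv2, add_mul, Finset.sum_add_distrib]

theorem conv2_add_right (F G G' : List A → List A → ℝ) (u v : List A) :
    conv2 F (G + G') u v = conv2 F G u v + conv2 F G' u v := by
  simp [conv2, mul_add, Finset.sum_add_distrib]

/-- The defect vanishes on the pairs of subwords of `u` and `v` other than `(u, v)`. -/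
def ProperChar (X : Ser A) (u v : List A) : Prop :=
  ∀ u' v' : List A, u'.Sublist u → v'.Sublist v →
    u'.length + v'.length < u.length + v.length → defect X u' v' = 0

theorem ProperChar.sublist {X : Ser A} {u v u' v' : List A} (h : ProperChar X u v)
    (hu : u'.Sublist u) (hv : v'.Sublist v) : ProperChar X u' v' :=
  fun u'' v'' hu' hv' hl => h u'' v'' (hu'.trans hu) (hv'.trans hv)
    (hl.trans_le (Nat.add_le_add hu.length_le hv.length_le))

/-- Write `sh` as the multiplicative part plus the defect and expand the convolution. Since proper
pairs have no defect, each defect survives only against the constant term of the other factor. -/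
theorem defect_mul {X Y : Ser A} (hX : X [] = 1) (hY : Y [] = 1) {u v : List A}
    (hXc : ProperChar X u v) (hYc : ProperChar Y u v) :
    defect (X * Y) u v = defect X u v + defect Y u v := by
  have hs : ∀ Z : Ser A, sh Z = (fun u v => Z u * Z v) + defect Z := by
    intro Z; funext u v; simp [defect]
  have h1 : conv2 (sh X) (sh Y) u v = (X * Y) u * (X * Y) v + defect Y u v + defect X u v := by
    rw [hs X, conv2_add_left, conv2_of_left_vanish _ fun i j h =>
      hXc _ _ (List.take_sublist i u) (List.take_sublist j v) h, hs Y, conv2_add_right, conv2_mul,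
      conv2_of_right_vanish _ fun i j h =>
      hYc _ _ (List.drop_sublist i u) (List.drop_sublist j v) h]
    simp [hX, hY, defect]
  rw [defect, sh_mul, h1]
  ring

theorem ProperChar.mul {X Y : Ser A} (hX : X [] = 1) (hY : Y [] = 1) {u v : List A}
    (hXc : ProperChar X u v) (hYc : ProperChar Y u v) : ProperChar (X * Y) u v := by
  intro u' v' hu hv hl
  rw [defect_mul hX hY (hXc.sublist hu hv) (hYc.sublist hu hv), hXc u' v' hu hv hl,
    hYc u' v' hu hv hl, add_zero]

theorem defect_one (u v : List A) : defect (1 : Ser A) u v = 0 := by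
  cases u with
  | nil => exact defect_nil_left rfl v
  | cons a u =>
    rw [defect, one_cons, zero_mul, sub_zero, sh]
    refine List.sum_eq_zero fun x hx => ?_
    obtain ⟨w, hw, rfl⟩ := List.mem_map.1 hx
    refine one_of_ne_nil fun h => ?_
    have := (perm_of_mem_shuffle hw).length_eq
    simp [h] at this

theorem pow_nil {X : Ser A} (hX : X [] = 1) (m : ℕ) : (X ^ m) [] = 1 := by
  induction m with
  | zero => rfl
  | succ m ih => rw [pow_succ, mul_nil, ih, hX, one_mul]

theorem defect_pow {X : Ser A} (hX : X [] = 1) {u v : List A} (h : ProperChar X u v) (m : ℕ) :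
    ProperChar (X ^ m) u v ∧ defect (X ^ m) u v = m * defect X u v := by
  induction m with
  | zero =>
    rw [pow_zero]
    exact ⟨fun u' v' _ _ _ => defect_one u' v', by simp [defect_one]⟩
  | succ m ih =>
    rw [pow_succ]
    refine ⟨ih.1.mul (pow_nil hX m) hX h, ?_⟩
    rw [defect_mul (pow_nil hX m) hX ih.1 h, ih.2]
    push_cast
    ring

open Polynomial in
/-- The polynomial in `m` whose values are the coefficients of `X ^ m`. -/
def powPoly (X : Ser A) (v : List A) : ℝ[X] :=
  ∑ k ∈ Finset.range (v.length + 1),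
    C (((X - 1) ^ k) v / (k.factorial : ℝ)) * descPochhammer ℝ k

theorem sum_apply {ι : Type*} (s : Finset ι) (f : ι → Ser A) (v : List A) :
    (∑ i ∈ s, f i) v = ∑ i ∈ s, f i v :=
  Finset.sum_apply v s f

/-- Binomial expansion of `(1 + (X - 1)) ^ m`; powers beyond the length of `v` vanish on `v`, so the
degree is bounded independently of `m`. -/
theorem powPoly_eval {X : Ser A} (hX : X [] = 1) (v : List A) (m : ℕ) :
    (powPoly X v).eval (m : ℝ) = (X ^ m) v := by
  have hN : (X - 1 : Ser A) [] = 0 := by simp [hX]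
  have h1 : (X ^ m) v = ∑ k ∈ Finset.range (m + 1), (m.choose k : ℝ) * ((X - 1) ^ k) v := by
    conv_lhs => rw [← sub_add_cancel X 1, (Commute.one_right (X - 1)).add_pow]
    rw [sum_apply]
    refine Finset.sum_congr rfl fun k _ => ?_
    rw [one_pow, mul_one, ← Nat.cast_comm, ← nsmul_eq_mul]
    exact nsmul_eq_mul _ _
  have h2 : (powPoly X v).eval (m : ℝ) =
      ∑ k ∈ Finset.range (v.length + 1), (m.choose k : ℝ) * ((X - 1) ^ k) v := by
    rw [powPoly, Polynomial.eval_finsetSum]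
    refine Finset.sum_congr rfl fun k _ => ?_
    rw [Polynomial.eval_mul, Polynomial.eval_C, descPochhammer_eval_eq_descFactorial,
      Nat.descFactorial_eq_factorial_mul_choose]
    have : (k.factorial : ℝ) ≠ 0 := by positivity
    push_cast
    field_simp
  rw [h1, h2]
  rcases le_total v.length m with h | h
  · refine Finset.sum_subset (Finset.range_mono (by omega)) fun k _ hk => ?_
    rw [Finset.mem_range, not_lt] at hk
    rw [pow_apply_of_length_lt hN k (by omega), mul_zero]
  · refine (Finset.sum_subset (Finset.range_mono (by omega)) fun k _ hk => ?_).symm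
    rw [Finset.mem_range, not_lt] at hk
    rw [Nat.choose_eq_zero_of_lt (by omega), Nat.cast_zero, zero_mul]

theorem descPochhammer_coeff_one (k : ℕ) :
    (descPochhammer ℝ (k + 1)).coeff 1 = (-1) ^ k * (k.factorial : ℝ) := by
  rw [descPochhammer_succ_left, Polynomial.coeff_X_mul, Polynomial.coeff_zero_eq_eval_zero,
    Polynomial.eval_comp]
  simp only [Polynomial.eval_sub, Polynomial.eval_X, Polynomial.eval_one, zero_sub]
  induction k with
  | zero => simp
  | succ k ih =>
    rw [descPochhammer_succ_eval, ih, Nat.factorial_succ]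
    push_cast
    ring

theorem powPoly_coeff_one (X : Ser A) (v : List A) : (powPoly X v).coeff 1 = log X v := by
  rw [powPoly, Polynomial.finsetSum_coeff, Finset.sum_range_succ']
  rw [log, ← Finset.Ico_add_one_right_eq_Icc, Finset.sum_Ico_eq_sum_range]
  simp only [Polynomial.coeff_C_mul, descPochhammer_coeff_one, descPochhammer_zero,
    Polynomial.coeff_one, add_tsub_cancel_right]
  simp only [one_ne_zero, if_false, mul_zero, add_zero]
  refine Finset.sum_congr rfl fun k _ => ?_
  rw [Nat.factorial_succ, add_comm 1 k]
  have : (k.factorial : ℝ) ≠ 0 := by positivity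
  push_cast
  field_simp
  ring

theorem polynomial_eq_of_nat {p q : Polynomial ℝ}
    (h : ∀ m : ℕ, p.eval (m : ℝ) = q.eval (m : ℝ)) : p = q :=
  Polynomial.eq_of_infinite_eval_eq p q
    ((Set.infinite_range_of_injective (Nat.cast_injective (R := ℝ))).mono
      (by rintro _ ⟨m, rfl⟩; exact h m))

theorem powPoly_coeff_zero {X : Ser A} (hX : X [] = 1) (v : List A) :
    (powPoly X v).coeff 0 = (1 : Ser A) v := by
  have := powPoly_eval hX v 0
  rwa [Nat.cast_zero, ← Polynomial.coeff_zero_eq_eval_zero, pow_zero] at this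

/-- The logarithm turns the defect of multiplicativity into the defect of being primitive. -/
theorem sh_log {X : Ser A} (hX : X [] = 1) {u v : List A} (hu : u ≠ []) (hv : v ≠ [])
    (h : ProperChar X u v) : sh (log X) u v = defect X u v := by
  -- At each natural `m` this says that the defect of `X ^ m` is `m` times that of `X`. Reading off
  -- the coefficient of the first power of `m` gives the claim: on the left it is the logarithm, and
  -- the product on the right contributes nothing, since both factors have zero constant term.
  have hp : ((shuffle u v).map (powPoly X)).sum =
      powPoly X u * powPoly X v + Polynomial.X * Polynomial.C (defect X u v) := by
    refine polynomial_eq_of_nat fun m => ?_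
    rw [← Polynomial.coe_evalRingHom, map_list_sum, List.map_map, map_add, map_mul]
    simp only [Polynomial.coe_evalRingHom, Polynomial.eval_mul, Polynomial.eval_X,
      Polynomial.eval_C, powPoly_eval hX]
    rw [← (defect_pow hX h m).2, defect, sh]
    have : (Polynomial.eval (m : ℝ) ∘ powPoly X) = fun w => (X ^ m : Ser A) w := by
      funext w
      exact powPoly_eval hX w m
    rw [this]
    ring
  have h1 := congrArg (Polynomial.lcoeff ℝ 1) hp
  rw [map_list_sum, List.map_map, map_add] at h1
  have h2 : (Polynomial.lcoeff ℝ 1 ∘ powPoly X) = fun w => log X w := by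
    funext w
    exact powPoly_coeff_one X w
  rw [h2] at h1
  rw [sh, h1]
  rw [Polynomial.lcoeff_apply, Polynomial.lcoeff_apply, Polynomial.coeff_X_mul,
    Polynomial.coeff_C_zero, Polynomial.mul_coeff_one, powPoly_coeff_zero hX,
    powPoly_coeff_zero hX, one_of_ne_nil hu, one_of_ne_nil hv]
  ring

/-- The equation `d/dt X ^ t = X ^ t * log X`, obtained by differentiating `X ^ (m + t) = X ^ m * X
^ t` at `t = 0`. -/
theorem powPoly_derivative {X : Ser A} (hX : X [] = 1) (v : List A) :
    Polynomial.derivative (powPoly X v) = ∑ i ∈ Finset.range (v.length + 1),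
      powPoly X (v.take i) * Polynomial.C (log X (v.drop i)) := by
  refine polynomial_eq_of_nat fun m => ?_
  have hp : (powPoly X v).comp (Polynomial.X + Polynomial.C (m : ℝ)) =
      ∑ i ∈ Finset.range (v.length + 1), Polynomial.C ((X ^ m) (v.take i)) *
        powPoly X (v.drop i) := by
    refine polynomial_eq_of_nat fun j => ?_
    rw [Polynomial.eval_comp, Polynomial.eval_finsetSum]
    simp only [Polynomial.eval_add, Polynomial.eval_X, Polynomial.eval_C, Polynomial.eval_mul,
      powPoly_eval hX]
    rw [← Nat.cast_add, powPoly_eval hX, add_comm, pow_add]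
    rfl
  have h1 := congrArg (fun p => (Polynomial.derivative p).eval 0) hp
  simp only [Polynomial.derivative_comp, Polynomial.derivative_sum, Polynomial.eval_mul,
    Polynomial.eval_comp, Polynomial.eval_finsetSum, Polynomial.derivative_C_mul,
    Polynomial.eval_C, Polynomial.eval_X, Polynomial.eval_add, Polynomial.derivative_add,
    Polynomial.derivative_X, Polynomial.derivative_C, zero_add, add_zero, one_mul] at h1
  rw [h1, Polynomial.eval_finsetSum]
  refine Finset.sum_congr rfl fun i _ => ?_
  rw [Polynomial.eval_mul, Polynomial.eval_C, powPoly_eval hX, ← powPoly_coeff_one,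
    ← Polynomial.coeff_zero_eq_eval_zero, Polynomial.coeff_derivative]
  simp

theorem powPoly_coeff {X : Ser A} (hX : X [] = 1) (k : ℕ) (v : List A) :
    (powPoly X v).coeff k = (log X ^ k) v / (k.factorial : ℝ) := by
  induction k generalizing v with
  | zero => simp [powPoly_coeff_zero hX]
  | succ k ih =>
    have h := congrArg (fun p => p.coeff k) (powPoly_derivative hX v)
    simp only [Polynomial.coeff_derivative, Polynomial.finsetSum_coeff,
      Polynomial.coeff_mul_C, ih] at h
    have hk : (k.factorial : ℝ) ≠ 0 := by positivity
    have hk' : (k : ℝ) + 1 ≠ 0 := by positivity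
    rw [pow_succ, mul_apply, Nat.factorial_succ, eq_div_iff (by positivity)]
    push_cast
    rw [← mul_assoc, h, Finset.sum_mul]
    refine Finset.sum_congr rfl fun i _ => ?_
    field_simp

/-- The differential equation determines the coefficients of `t ↦ X ^ t` as those of `exp (t log
X)`; evaluate at `t = 1`. -/
theorem exp_log {X : Ser A} (hX : X [] = 1) : exp (log X) = X := by
  ext v
  have h := powPoly_eval hX v 1
  rw [pow_one, Nat.cast_one] at h
  have hd : (powPoly X v).natDegree < v.length + 1 := by
    refine Nat.lt_succ_of_le (Polynomial.natDegree_sum_le_of_forall_le _ _ fun k hk => ?_)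
    refine (Polynomial.natDegree_C_mul_le _ _).trans ?_
    rw [descPochhammer_natDegree]
    exact Nat.lt_succ_iff.1 (Finset.mem_range.1 hk)
  rw [← h, Polynomial.eval_eq_sum_range' hd, exp]
  exact Finset.sum_congr rfl fun k _ => by rw [powPoly_coeff hX, one_pow, mul_one]

end Ser

/-! ### Dyadic paths for almost additive functions -/

/-- `b` is additive up to an error of order `β`. -/
def IsAlmostAdditive (b : ℝ → ℝ → ℝ) (β C : ℝ) : Prop :=
  ∀ s u t r : ℝ, |u - s| ≤ r → |t - u| ≤ r → |t - s| ≤ r → |b s t - b s u - b u t| ≤ C * r ^ β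

/-- The dyadic point `k / 2 ^ n`. -/
def dyadic (n k : ℕ) : ℝ := (k : ℝ) / 2 ^ n

theorem dyadic_succ_two_mul (n k : ℕ) : dyadic (n + 1) (2 * k) = dyadic n k := by
  simp only [dyadic, pow_succ]
  push_cast
  field_simp

theorem dyadic_succ_sub (n k : ℕ) : dyadic n (k + 1) - dyadic n k = (1 / 2) ^ n := by
  simp only [dyadic, one_div, inv_pow]
  push_cast
  field_simp
  ring

/-- The values on dyadic points of the path whose increments differ from `b` by equal amounts
on the two halves of each dyadic interval. -/
def dyadicPath (b : ℝ → ℝ → ℝ) : ℕ → ℕ → ℝ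
  | 0, k => ∑ i ∈ Finset.range k, b (dyadic 0 i) (dyadic 0 (i + 1))
  | n + 1, j =>
    if j % 2 = 0 then dyadicPath b n (j / 2)
    else (dyadicPath b n (j / 2) + dyadicPath b n (j / 2 + 1)
      + b (dyadic n (j / 2)) (dyadic (n + 1) j) - b (dyadic (n + 1) j) (dyadic n (j / 2 + 1))) / 2

theorem dyadicPath_even (b : ℝ → ℝ → ℝ) (n k : ℕ) :
    dyadicPath b (n + 1) (2 * k) = dyadicPath b n k := by
  rw [dyadicPath, if_pos (by omega), show 2 * k / 2 = k by omega]

theorem dyadicPath_odd (b : ℝ → ℝ → ℝ) (n k : ℕ) :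
    dyadicPath b (n + 1) (2 * k + 1) = (dyadicPath b n k + dyadicPath b n (k + 1)
      + b (dyadic n k) (dyadic (n + 1) (2 * k + 1))
      - b (dyadic (n + 1) (2 * k + 1)) (dyadic n (k + 1))) / 2 := by
  rw [dyadicPath, if_neg (by omega), show (2 * k + 1) / 2 = k by omega]

/-- The difference between the increment of `dyadicPath` and `b` on a dyadic interval. -/
def dyadicError (b : ℝ → ℝ → ℝ) (n k : ℕ) : ℝ :=
  dyadicPath b n (k + 1) - dyadicPath b n k - b (dyadic n k) (dyadic n (k + 1))

theorem dyadicError_left (b : ℝ → ℝ → ℝ) (n k : ℕ) :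
    dyadicError b (n + 1) (2 * k) = (dyadicError b n k +
      (b (dyadic n k) (dyadic n (k + 1)) - b (dyadic n k) (dyadic (n + 1) (2 * k + 1))
        - b (dyadic (n + 1) (2 * k + 1)) (dyadic n (k + 1)))) / 2 := by
  rw [dyadicError, dyadicPath_odd, dyadicPath_even, dyadic_succ_two_mul, dyadicError]
  ring

theorem dyadicError_right (b : ℝ → ℝ → ℝ) (n k : ℕ) :
    dyadicError b (n + 1) (2 * k + 1) = (dyadicError b n k +
      (b (dyadic n k) (dyadic n (k + 1)) - b (dyadic n k) (dyadic (n + 1) (2 * k + 1))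
        - b (dyadic (n + 1) (2 * k + 1)) (dyadic n (k + 1)))) / 2 := by
  rw [dyadicError, show 2 * k + 1 + 1 = 2 * (k + 1) by ring, dyadicPath_odd, dyadicPath_even,
    dyadic_succ_two_mul, dyadicError]
  ring

theorem half_rpow_lt_one {β : ℝ} (hβ : 0 < β) : ((1 : ℝ) / 2) ^ β < 1 :=
  Real.rpow_lt_one (by norm_num) (by norm_num) hβ

theorem one_lt_two_mul_half_rpow {β : ℝ} (hβ : β < 1) : 1 < 2 * ((1 : ℝ) / 2) ^ β := by
  have := Real.rpow_lt_rpow_of_exponent_gt (x := (1 : ℝ) / 2) (by norm_num) (by norm_num) hβ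
  rw [Real.rpow_one] at this
  linarith

section

variable {b : ℝ → ℝ → ℝ} {β C : ℝ}

theorem IsAlmostAdditive.nonneg (hb : IsAlmostAdditive b β C) : 0 ≤ C := by
  have := hb 0 0 0 1 (by simp) (by simp) (by simp)
  rw [Real.one_rpow, mul_one] at this
  exact (abs_nonneg _).trans this

theorem IsAlmostAdditive.self (hb : IsAlmostAdditive b β C) (hβ : 0 < β) (s : ℝ) : b s s = 0 := by
  have := hb s s s 0 (by simp) (by simp) (by simp)
  rw [Real.zero_rpow hβ.ne', mul_zero, abs_nonpos_iff] at this
  linarith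

theorem IsAlmostAdditive.pow_half (hb : IsAlmostAdditive b β C) {s u t : ℝ} (n : ℕ)
    (h1 : |u - s| ≤ (1 / 2) ^ n) (h2 : |t - u| ≤ (1 / 2) ^ n) (h3 : |t - s| ≤ (1 / 2) ^ n) :
    |b s t - b s u - b u t| ≤ C * ((1 / 2 : ℝ) ^ β) ^ n := by
  rw [Real.rpow_pow_comm (by norm_num)]
  exact hb s u t _ h1 h2 h3

theorem dyadic_mid_sub_left (n k : ℕ) :
    dyadic (n + 1) (2 * k + 1) - dyadic n k = (1 / 2) ^ (n + 1) := by
  rw [← dyadic_succ_two_mul n k, dyadic_succ_sub]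

theorem dyadic_sub_mid (n k : ℕ) :
    dyadic n (k + 1) - dyadic (n + 1) (2 * k + 1) = (1 / 2) ^ (n + 1) := by
  rw [← dyadic_succ_two_mul n, ← dyadic_succ_sub _ (2 * k + 1)]
  rfl

theorem half_pow_succ_le (n : ℕ) : ((1 : ℝ) / 2) ^ (n + 1) ≤ (1 / 2) ^ n :=
  pow_le_pow_of_le_one (by norm_num) (by norm_num) (Nat.le_succ n)

/-- With `q = (1 / 2) ^ β`, a bound `K * q ^ n` propagates through the recursion when `(K + C) / 2 =
K * q`, that is `K = C / (2 * q - 1)`. Positivity of `2 * q - 1` is where `β < 1` is needed. -/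
theorem dyadicError_le (hb : IsAlmostAdditive b β C) (hβ1 : β < 1) (n k : ℕ) :
    |dyadicError b n k| ≤ C / (2 * (1 / 2 : ℝ) ^ β - 1) * ((1 / 2 : ℝ) ^ β) ^ n := by
  have hq := one_lt_two_mul_half_rpow hβ1
  have hC := hb.nonneg
  induction n generalizing k with
  | zero =>
    have : dyadicError b 0 k = 0 := by
      simp only [dyadicError, dyadicPath, Finset.sum_range_succ]
      ring
    rw [this, abs_zero, pow_zero, mul_one]
    exact div_nonneg hC (by linarith)
  | succ n ih =>
    have hp : (0 : ℝ) ≤ (1 / 2) ^ (n + 1) := by positivity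
    have main : ∀ j, |(dyadicError b n j +
        (b (dyadic n j) (dyadic n (j + 1)) - b (dyadic n j) (dyadic (n + 1) (2 * j + 1))
        - b (dyadic (n + 1) (2 * j + 1)) (dyadic n (j + 1)))) / 2| ≤
        C / (2 * (1 / 2 : ℝ) ^ β - 1) * ((1 / 2 : ℝ) ^ β) ^ (n + 1) := by
      intro j
      have key := hb.pow_half (s := dyadic n j) (u := dyadic (n + 1) (2 * j + 1))
        (t := dyadic n (j + 1)) n
        (by rw [dyadic_mid_sub_left, abs_of_nonneg hp]; exact half_pow_succ_le n)
        (by rw [dyadic_sub_mid, abs_of_nonneg hp]; exact half_pow_succ_le n)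
        (by rw [dyadic_succ_sub, abs_of_nonneg (by positivity)])
      rw [abs_div, abs_two, div_le_iff₀ two_pos]
      refine (abs_add_le _ _).trans ((add_le_add (ih j) key).trans (le_of_eq ?_))
      have hne : 2 * (1 / 2 : ℝ) ^ β - 1 ≠ 0 := by linarith
      rw [pow_succ]
      field_simp
      ring
    rcases Nat.even_or_odd' k with ⟨j, rfl | rfl⟩
    · rw [dyadicError_left]; exact main j
    · rw [dyadicError_right]; exact main j

/-- The approximation at level `n` of the path with the increments prescribed by `dyadicPath`. -/
def pathApprox (b : ℝ → ℝ → ℝ) (t : ℝ) (n : ℕ) : ℝ :=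
  dyadicPath b n ⌊2 ^ n * t⌋₊ + b (dyadic n ⌊2 ^ n * t⌋₊) t

theorem dyadic_floor_le {t : ℝ} (ht : 0 ≤ t) (n : ℕ) : dyadic n ⌊2 ^ n * t⌋₊ ≤ t := by
  rw [dyadic, div_le_iff₀ (by positivity), mul_comm t]
  exact Nat.floor_le (by positivity)

theorem sub_dyadic_floor_le (t : ℝ) (n : ℕ) : t - dyadic n ⌊2 ^ n * t⌋₊ ≤ (1 / 2) ^ n := by
  have := (Nat.lt_floor_add_one (2 ^ n * t)).le
  rw [sub_le_iff_le_add, dyadic, one_div, inv_pow, ← one_div, ← add_div,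
    le_div_iff₀ (by positivity)]
  linarith

theorem abs_sub_dyadic_floor_le {t : ℝ} (ht : 0 ≤ t) (n : ℕ) :
    |t - dyadic n ⌊2 ^ n * t⌋₊| ≤ (1 / 2) ^ n := by
  rw [abs_of_nonneg (sub_nonneg.2 (dyadic_floor_le ht n))]
  exact sub_dyadic_floor_le t n

/-- Refining either keeps the dyadic point below `t` or moves it to a midpoint. In the second case
the change is a dyadic error minus one additivity defect of `b`. -/
theorem dist_pathApprox_succ_le (hb : IsAlmostAdditive b β C) (hβ : 0 < β) (hβ1 : β < 1)
    {t : ℝ} (ht : 0 ≤ t) (n : ℕ) :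
    dist (pathApprox b t n) (pathApprox b t (n + 1)) ≤
      (C / (2 * (1 / 2 : ℝ) ^ β - 1) + C) * ((1 / 2 : ℝ) ^ β) ^ n := by
  have hq := one_lt_two_mul_half_rpow hβ1
  have hC := hb.nonneg
  have hK : 0 ≤ C / (2 * (1 / 2 : ℝ) ^ β - 1) := div_nonneg hC (by linarith)
  have hq0 : 0 ≤ ((1 / 2 : ℝ) ^ β) ^ n := by positivity
  have hfl : ⌊(2 : ℝ) ^ n * t⌋₊ = ⌊(2 : ℝ) ^ (n + 1) * t⌋₊ / 2 := by
    rw [← Nat.floor_div_ofNat, pow_succ]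
    congr 1
    ring
  rw [dist_comm, Real.dist_eq, pathApprox, pathApprox]
  have hd' := dyadic_floor_le ht (n + 1)
  have hs' := sub_dyadic_floor_le t (n + 1)
  have hs := abs_sub_dyadic_floor_le ht n
  set k := ⌊(2 : ℝ) ^ n * t⌋₊ with hk
  have : ⌊(2 : ℝ) ^ (n + 1) * t⌋₊ = 2 * k ∨ ⌊(2 : ℝ) ^ (n + 1) * t⌋₊ = 2 * k + 1 := by omega
  rcases this with h | h
  · rw [h, dyadicPath_even, dyadic_succ_two_mul, sub_self, abs_zero]
    positivity
  · rw [h] at hd' hs' ⊢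
    have h1 := dyadicError_le hb hβ1 (n + 1) (2 * k)
    have h2 := hb.pow_half (s := dyadic n k) (u := dyadic (n + 1) (2 * k + 1)) (t := t) n
      (by rw [dyadic_mid_sub_left, abs_of_nonneg (by positivity)]; exact half_pow_succ_le n)
      (by rw [abs_of_nonneg (by linarith)]; exact hs'.trans (half_pow_succ_le n)) hs
    have h3 : ((1 / 2 : ℝ) ^ β) ^ (n + 1) ≤ ((1 / 2 : ℝ) ^ β) ^ n :=
      pow_le_pow_of_le_one (by positivity) (half_rpow_lt_one hβ).le (Nat.le_succ n)
    rw [dyadicError, dyadicPath_even, dyadic_succ_two_mul] at h1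
    have h4 : dyadicPath b (n + 1) (2 * k + 1) + b (dyadic (n + 1) (2 * k + 1)) t
        - (dyadicPath b n k + b (dyadic n k) t) =
        (dyadicPath b (n + 1) (2 * k + 1) - dyadicPath b n k
          - b (dyadic n k) (dyadic (n + 1) (2 * k + 1)))
        - (b (dyadic n k) t - b (dyadic n k) (dyadic (n + 1) (2 * k + 1))
          - b (dyadic (n + 1) (2 * k + 1)) t) := by ring
    rw [h4, add_mul]
    exact (abs_sub _ _).trans (add_le_add (h1.trans (mul_le_mul_of_nonneg_left h3 hK)) h2)

theorem dyadicPath_refine (b : ℝ → ℝ → ℝ) (n k j : ℕ) :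
    dyadicPath b (n + j) (2 ^ j * k) = dyadicPath b n k := by
  induction j with
  | zero => simp
  | succ j ih => rw [← ih, ← add_assoc, ← dyadicPath_even b (n + j), pow_succ', mul_assoc]

theorem dyadic_refine (n k j : ℕ) : dyadic (n + j) (2 ^ j * k) = dyadic n k := by
  induction j with
  | zero => simp
  | succ j ih => rw [← ih, ← add_assoc, ← dyadic_succ_two_mul (n + j), pow_succ', mul_assoc]

theorem pathApprox_dyadic (hb : IsAlmostAdditive b β C) (hβ : 0 < β) (n k j : ℕ) :
    pathApprox b (dyadic n k) (n + j) = dyadicPath b n k := by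
  have h : ⌊(2 : ℝ) ^ (n + j) * dyadic n k⌋₊ = 2 ^ j * k := by
    rw [← dyadic_refine n k j, dyadic, mul_div_cancel₀ _ (by positivity), Nat.floor_natCast]
  rw [pathApprox, h, dyadicPath_refine, dyadic_refine, hb.self hβ, add_zero]

/-- The increments of `dyadicPath` between points at distance at most one. -/
theorem dyadicPath_sub_le (hb : IsAlmostAdditive b β C) (hβ : 0 < β) (hβ1 : β < 1) (n i j : ℕ)
    (hij : i ≤ j + 1) (hji : j ≤ i + 1) :
    |dyadicPath b n j - dyadicPath b n i - b (dyadic n i) (dyadic n j)| ≤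
      (C / (2 * (1 / 2 : ℝ) ^ β - 1) + C) * ((1 / 2 : ℝ) ^ β) ^ n := by
  have hq := one_lt_two_mul_half_rpow hβ1
  have hC := hb.nonneg
  have hK : 0 ≤ C / (2 * (1 / 2 : ℝ) ^ β - 1) := div_nonneg hC (by linarith)
  have hq0 : 0 ≤ ((1 / 2 : ℝ) ^ β) ^ n := by positivity
  have hp : (0 : ℝ) ≤ (1 / 2) ^ n := by positivity
  have : i = j ∨ j = i + 1 ∨ i = j + 1 := by omega
  rcases this with rfl | rfl | rfl
  · rw [hb.self hβ, sub_self, sub_zero, abs_zero]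
    positivity
  · refine (dyadicError_le hb hβ1 n i).trans (mul_le_mul_of_nonneg_right ?_ hq0)
    linarith
  -- For a reversed interval, almost additivity on the round trip, with `b` zero on the diagonal,
  -- compares the two orientations.
  · have h1 := dyadicError_le hb hβ1 n j
    have h2 := hb.pow_half (s := dyadic n j) (u := dyadic n (j + 1)) (t := dyadic n j) n
      (by rw [dyadic_succ_sub, abs_of_nonneg hp])
      (by rw [abs_sub_comm, dyadic_succ_sub, abs_of_nonneg hp]) (by simp)
    rw [hb.self hβ] at h2
    have h3 : dyadicPath b n j - dyadicPath b n (j + 1) - b (dyadic n (j + 1)) (dyadic n j) =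
        (0 - b (dyadic n j) (dyadic n (j + 1)) - b (dyadic n (j + 1)) (dyadic n j))
          - dyadicError b n j := by
      rw [dyadicError]; ring
    rw [h3, add_mul, add_comm (_ * _)]
    exact (abs_sub _ _).trans (add_le_add h2 h1)

/-- Compare `s` and `t` with the level-`n` dyadic points `p`, `q` below them, whose indices differ
by at most one. Almost additivity at `(p, q, t)` and `(p, s, t)`, at scale `2 * (1 / 2) ^ n`,
accounts for the term `2 * (C * 2 ^ β)`. -/
theorem abs_path_sub_le (hb : IsAlmostAdditive b β C) (hβ : 0 < β) (hβ1 : β < 1) {F : ℝ → ℝ}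
    {K : ℝ} (hF : ∀ t, 0 ≤ t → ∀ n, |pathApprox b t n - F t| ≤ K * ((1 / 2 : ℝ) ^ β) ^ n)
    {s t : ℝ} (hs : 0 ≤ s) (ht : 0 ≤ t) (n : ℕ) (hst : |t - s| ≤ (1 / 2) ^ n) :
    |F t - F s - b s t| ≤
      (2 * K + (C / (2 * (1 / 2 : ℝ) ^ β - 1) + C) + 2 * (C * 2 ^ β)) * ((1 / 2 : ℝ) ^ β) ^ n := by
  have hq : (2 * (1 / 2 : ℝ) ^ n) ^ β = 2 ^ β * ((1 / 2 : ℝ) ^ β) ^ n := by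
    rw [Real.mul_rpow (by norm_num) (by positivity), Real.rpow_pow_comm (by norm_num)]
  have hp : (0 : ℝ) ≤ (1 / 2) ^ n := by positivity
  have hFt := hF t ht n
  have hFs := hF s hs n
  have ds := abs_sub_dyadic_floor_le hs n
  have dt := abs_sub_dyadic_floor_le ht n
  have h2n : (2 : ℝ) ^ n * (1 / 2) ^ n = 1 := by rw [← mul_pow]; norm_num
  have h2p : (0 : ℝ) < 2 ^ n := by positivity
  have hst' := abs_le.1 hst
  have key1 : ⌊(2 : ℝ) ^ n * s⌋₊ ≤ ⌊(2 : ℝ) ^ n * t⌋₊ + 1 := by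
    rw [← Nat.floor_add_one (by positivity)]
    refine Nat.floor_le_floor ?_
    nlinarith
  have key2 : ⌊(2 : ℝ) ^ n * t⌋₊ ≤ ⌊(2 : ℝ) ^ n * s⌋₊ + 1 := by
    rw [← Nat.floor_add_one (by positivity)]
    refine Nat.floor_le_floor ?_
    nlinarith
  have hA := dyadicPath_sub_le hb hβ hβ1 n _ _ key1 key2
  have dij : |dyadic n ⌊(2 : ℝ) ^ n * t⌋₊ - dyadic n ⌊(2 : ℝ) ^ n * s⌋₊| ≤ (1 / 2) ^ n := by
    rw [dyadic, dyadic, ← sub_div, abs_div, abs_of_pos h2p, div_le_iff₀ h2p, mul_comm (_ ^ n) (_ ^ n), h2n]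
    have k1 : ((⌊(2 : ℝ) ^ n * s⌋₊ : ℕ) : ℝ) ≤ (⌊(2 : ℝ) ^ n * t⌋₊ : ℕ) + 1 := by
      exact_mod_cast key1
    have k2 : ((⌊(2 : ℝ) ^ n * t⌋₊ : ℕ) : ℝ) ≤ (⌊(2 : ℝ) ^ n * s⌋₊ : ℕ) + 1 := by
      exact_mod_cast key2
    rw [abs_le]
    constructor <;> linarith
  rw [pathApprox] at hFt hFs
  set p := dyadic n ⌊(2 : ℝ) ^ n * s⌋₊
  set q := dyadic n ⌊(2 : ℝ) ^ n * t⌋₊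
  have dpt : |t - p| ≤ 2 * (1 / 2) ^ n := by
    have := abs_add_le (t - q) (q - p)
    rw [sub_add_sub_cancel] at this
    linarith
  have hB := hb p q t (2 * (1 / 2) ^ n) (by linarith) (by linarith) dpt
  have hD := hb p s t (2 * (1 / 2) ^ n) (by linarith) (by linarith) dpt
  rw [hq, ← mul_assoc] at hB hD
  rw [abs_le] at *
  constructor <;> linarith [hFt.1, hFt.2, hFs.1, hFs.2, hA.1, hA.2, hB.1, hB.2, hD.1, hD.2]

/-- An almost additive function of order `β < 1` differs from the increments of a path by an error
of order `β`, and the path is determined by the choice of equal errors on the two halves of each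
dyadic interval. -/
theorem exists_dyadic_path (hb : IsAlmostAdditive b β C) (hβ : 0 < β) (hβ1 : β < 1) :
    ∃ (F : ℝ → ℝ) (K : ℝ), F 1 - F 0 - b 0 1 = 0 ∧
      (∀ m k : ℕ, F ((2 * k + 1) / 2 ^ (m + 1)) - F (k / 2 ^ m)
          - b (k / 2 ^ m) ((2 * k + 1) / 2 ^ (m + 1)) =
        F ((k + 1) / 2 ^ m) - F ((2 * k + 1) / 2 ^ (m + 1))
          - b ((2 * k + 1) / 2 ^ (m + 1)) ((k + 1) / 2 ^ m)) ∧
      ∀ s t : ℝ, 0 ≤ s → 0 ≤ t → |t - s| ≤ 1 → |F t - F s - b s t| ≤ K * |t - s| ^ β := by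
  have hq1 := half_rpow_lt_one hβ
  set q := (1 / 2 : ℝ) ^ β with hq
  have hq0 : 0 < q := by positivity
  have hlim : ∀ t : ℝ, ∃ l, 0 ≤ t → Filter.Tendsto (pathApprox b t) Filter.atTop (nhds l) := by
    intro t
    by_cases ht : 0 ≤ t
    · obtain ⟨l, hl⟩ := cauchySeq_tendsto_of_complete
        (cauchySeq_of_le_geometric _ _ hq1 (dist_pathApprox_succ_le hb hβ hβ1 ht))
      exact ⟨l, fun _ => hl⟩
    · exact ⟨0, fun h => absurd h ht⟩
  choose F hF using hlim
  have hdy : ∀ n k, F (dyadic n k) = dyadicPath b n k := by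
    intro n k
    have h0 : 0 ≤ dyadic n k := by unfold dyadic; positivity
    have h1 := (Filter.tendsto_add_atTop_iff_nat n).2 (hF _ h0)
    refine tendsto_nhds_unique h1 ?_
    simp only [add_comm _ n, pathApprox_dyadic hb hβ]
    exact tendsto_const_nhds
  have hFK : ∀ t, 0 ≤ t → ∀ n, |pathApprox b t n - F t| ≤
      ((C / (2 * q - 1) + C) / (1 - q)) * q ^ n := by
    intro t ht n
    have := dist_le_of_le_geometric_of_tendsto q _ hq1 (dist_pathApprox_succ_le hb hβ hβ1 ht)
      (hF t ht) n
    rw [Real.dist_eq] at this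
    exact this.trans (le_of_eq (by ring))
  obtain ⟨K, hK⟩ : ∃ K, K = 2 * ((C / (2 * q - 1) + C) / (1 - q)) + (C / (2 * q - 1) + C)
    + 2 * (C * 2 ^ β) := ⟨_, rfl⟩
  have hK0 : 0 ≤ K := by
    have h1 := one_lt_two_mul_half_rpow hβ1
    have h2 := hb.nonneg
    have h3 : 0 ≤ C / (2 * q - 1) := div_nonneg h2 (by linarith)
    have h4 : 0 ≤ (C / (2 * q - 1) + C) / (1 - q) := div_nonneg (by linarith) (by linarith)
    have h5 : 0 ≤ C * 2 ^ β := by positivity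
    linarith
  refine ⟨F, K * 2 ^ β, ?_, ?_, ?_⟩
  · have h0 := hdy 0 0
    have h1 := hdy 0 1
    simp only [dyadic, dyadicPath] at h0 h1
    norm_num at h0 h1
    rw [h0, h1]
    simp
  · intro m k
    have h1 := hdy m k
    have h2 := hdy (m + 1) (2 * k + 1)
    have h3 := hdy m (k + 1)
    have h4 := dyadicPath_odd b m k
    simp only [dyadic] at h1 h2 h3 h4
    push_cast at h1 h2 h3 h4
    rw [h1, h2, h3, h4]
    ring
  · intro s t hs ht hst
    rcases eq_or_ne s t with rfl | hne
    · rw [hb.self hβ, sub_self, sub_zero, sub_self, abs_zero, Real.zero_rpow hβ.ne', mul_zero]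
    -- The scale with `(1 / 2) ^ (n + 1) < |t - s| ≤ (1 / 2) ^ n`; replacing `(1 / 2) ^ n` by `2 *
    -- |t - s|` costs the factor `2 ^ β`.
    · obtain ⟨n, hn1, hn2⟩ := exists_nat_pow_near_of_lt_one
        (abs_pos.2 (sub_ne_zero.2 hne.symm)) hst (y := (1 / 2 : ℝ)) (by norm_num) (by norm_num)
      refine (abs_path_sub_le hb hβ hβ1 hFK hs ht n hn2).trans ?_
      rw [← hK, mul_assoc]
      refine mul_le_mul_of_nonneg_left ?_ hK0
      rw [Real.rpow_pow_comm (by norm_num), ← Real.mul_rpow (by norm_num) (abs_nonneg _)]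
      refine Real.rpow_le_rpow (by positivity) ?_ hβ.le
      rw [pow_succ] at hn1
      linarith

end

theorem exists_dyadic_path_unitInterval {b : I → I → ℝ} {β C : ℝ} (hβ : 0 < β) (hβ1 : β < 1)
    (hb : ∀ (s u t : I) (r : ℝ), |(u : ℝ) - s| ≤ r → |(t : ℝ) - u| ≤ r → |(t : ℝ) - s| ≤ r →
      |b s t - b s u - b u t| ≤ C * r ^ β) :
    ∃ (F : I → ℝ) (K : ℝ), F 1 - F 0 - b 0 1 = 0 ∧
      (∀ (m k : ℕ) (s u t : I), (s : ℝ) = k / 2 ^ m → (u : ℝ) = (2 * k + 1) / 2 ^ (m + 1) →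
        (t : ℝ) = (k + 1) / 2 ^ m → F u - F s - b s u = F t - F u - b u t) ∧
      ∀ s t : I, |F t - F s - b s t| ≤ K * |(t : ℝ) - s| ^ β := by
  -- Projection onto the interval is 1-Lipschitz, so the extension of `b` to the line keeps the same
  -- constant.
  let p : ℝ → I := Set.projIcc 0 1 zero_le_one
  have hp : ∀ t : I, p t = t := Set.projIcc_val zero_le_one
  have hpp : ∀ s t : ℝ, |(p t : ℝ) - p s| ≤ |t - s| := fun s t =>
    Set.abs_projIcc_sub_projIcc zero_le_one
  have hb' : IsAlmostAdditive (fun s t => b (p s) (p t)) β C := fun s u t r h1 h2 h3 =>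
    hb _ _ _ r ((hpp _ _).trans h1) ((hpp _ _).trans h2) ((hpp _ _).trans h3)
  obtain ⟨F, K, h01, hhalf, hF⟩ := exists_dyadic_path hb' hβ hβ1
  refine ⟨fun t => F t, K, ?_, ?_, ?_⟩
  · have h0 := hp 0
    have h1 := hp 1
    simp only [Set.Icc.coe_zero, Set.Icc.coe_one] at h0 h1 h01 ⊢
    rwa [h0, h1] at h01
  · intro m k s u t hs hu ht
    have := hhalf m k
    rw [← hs, ← hu, ← ht] at this
    simpa only [hp] using this
  · intro s t
    have := hF s t s.2.1 t.2.1 (abs_le.2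
      ⟨by linarith [s.2.2, t.2.1], by linarith [s.2.1, t.2.2]⟩)
    simpa only [hp] using this

/-- Equal halves of zero are zero, so `D` vanishes on every dyadic interval, hence by additivity
from `0` to every dyadic point. The Hölder bound then reaches all points. Any positive `β` suffices.
-/
theorem eq_zero_of_additive_of_dyadic {D : I → I → ℝ} {β C : ℝ} (hβ : 0 < β)
    (hadd : ∀ s u t, D s u + D u t = D s t) (h01 : D 0 1 = 0)
    (hhalf : ∀ (m k : ℕ) (s u t : I), (s : ℝ) = k / 2 ^ m → (u : ℝ) = (2 * k + 1) / 2 ^ (m + 1) →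
      (t : ℝ) = (k + 1) / 2 ^ m → D s u = D u t)
    (hD : ∀ s t : I, |D s t| ≤ C * |(t : ℝ) - s| ^ β) (s t : I) : D s t = 0 := by
  have h1 : ∀ (m k : ℕ) (s t : I), (s : ℝ) = k / 2 ^ m → (t : ℝ) = (k + 1) / 2 ^ m →
      D s t = 0 := by
    intro m
    induction m with
    | zero =>
      intro k s t hs ht
      have := t.2.2
      rw [ht, pow_zero, div_one] at this
      have hk : k = 0 := by
        have : (k : ℝ) ≤ 0 := by linarith
        exact_mod_cast this.antisymm (Nat.cast_nonneg k)
      subst hk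
      have hs' : s = 0 := Subtype.ext (by simpa using hs)
      have ht' : t = 1 := Subtype.ext (by simpa using ht)
      rw [hs', ht', h01]
    | succ m ih =>
      intro k s t hs ht
      have hm : (0 : ℝ) < 2 ^ m := by positivity
      rcases Nat.even_or_odd' k with ⟨j, rfl | rfl⟩
      · have hle : (j : ℝ) + 1 ≤ 2 ^ m := by
          have h := t.2.2
          rw [ht, div_le_one (by positivity)] at h
          have h' : 2 * j + 1 ≤ 2 ^ (m + 1) := by exact_mod_cast h
          have : j + 1 ≤ 2 ^ m := by rw [pow_succ] at h'; omega
          exact_mod_cast this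
        let w : I := ⟨(j + 1) / 2 ^ m, by positivity, (div_le_one hm).2 hle⟩
        have hs' : (s : ℝ) = j / 2 ^ m := by
          rw [hs, pow_succ]; push_cast; field_simp
        have ht' : (t : ℝ) = (2 * j + 1) / 2 ^ (m + 1) := by rw [ht]; push_cast; ring
        have e1 := hhalf m j s t w hs' ht' rfl
        have e2 := ih j s w hs' rfl
        have e3 := hadd s t w
        linarith
      · have hle : (j : ℝ) ≤ 2 ^ m := by
          have h := t.2.2
          rw [ht, div_le_one (by positivity), pow_succ] at h
          push_cast at h
          linarith
        let w : I := ⟨j / 2 ^ m, by positivity, (div_le_one hm).2 hle⟩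
        have hs' : (s : ℝ) = (2 * j + 1) / 2 ^ (m + 1) := by rw [hs]; push_cast; ring
        have ht' : (t : ℝ) = (j + 1) / 2 ^ m := by
          rw [ht, pow_succ]; push_cast; field_simp; ring
        have e1 := hhalf m j w s t rfl hs' ht'
        have e2 := ih j w t rfl ht'
        have e3 := hadd w s t
        linarith
  have h2 : ∀ (m k : ℕ) (s : I), (s : ℝ) = k / 2 ^ m → D 0 s = 0 := by
    intro m k
    induction k with
    | zero =>
      intro s hs
      have hs' : s = 0 := Subtype.ext (by simpa using hs)
      have := hadd 0 0 0
      rw [hs']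
      linarith
    | succ k ih =>
      intro s hs
      have hm : (0 : ℝ) < 2 ^ m := by positivity
      have hle : (k : ℝ) ≤ 2 ^ m := by
        have h := s.2.2
        rw [hs, div_le_one hm] at h
        push_cast at h
        linarith
      let w : I := ⟨k / 2 ^ m, by positivity, (div_le_one hm).2 hle⟩
      rw [← hadd 0 w s, ih w rfl, h1 m k w s rfl (by rw [hs]; push_cast; ring), add_zero]
  have h3 : ∀ t : I, D 0 t = 0 := by
    intro t
    have hlim : Filter.Tendsto (fun n : ℕ => |C| * ((1 / 2 : ℝ) ^ β) ^ n) Filter.atTop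
        (nhds 0) := by
      simpa using (tendsto_pow_atTop_nhds_zero_of_lt_one (by positivity)
        (half_rpow_lt_one hβ)).const_mul |C|
    refine abs_nonpos_iff.1 (ge_of_tendsto' hlim fun n => ?_)
    let w : I := ⟨dyadic n ⌊2 ^ n * (t : ℝ)⌋₊, by unfold dyadic; positivity,
      (dyadic_floor_le t.2.1 n).trans t.2.2⟩
    rw [← hadd 0 w t, h2 n _ w rfl, zero_add]
    refine (hD w t).trans ((mul_le_mul_of_nonneg_right (le_abs_self C) (by positivity)).trans ?_)
    refine mul_le_mul_of_nonneg_left ?_ (abs_nonneg C)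
    rw [Real.rpow_pow_comm (by norm_num)]
    exact Real.rpow_le_rpow (abs_nonneg _) (abs_sub_dyadic_floor_le t.2.1 n) hβ.le
  have := hadd 0 s t
  rw [h3, h3] at this
  linarith

/-! ### Weighted bounds, stable under products, logarithm and shuffle -/

/-- A family of series whose coefficients at `v` are of order `r ^ weight γ v`. -/
def IsWeighted (γ : A → ℝ) {ι : Type*} (r : ι → ℝ) (X : ι → Ser A) : Prop :=
  ∀ v, ∃ C : ℝ, ∀ i, |X i v| ≤ C * r i ^ weight γ v

namespace IsWeighted

variable {γ : A → ℝ} {ι : Type*} {r : ι → ℝ} {X Y : ι → Ser A}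

/-- Brings bounds at several distances to one common scale, so that they can be added and
multiplied. -/
theorem comp {κ : Type*} (hγ : ∀ a, 0 < γ a) (hX : IsWeighted γ r X) (f : κ → ι) {r' : κ → ℝ}
    (hr : ∀ k, 0 ≤ r (f k)) (h : ∀ k, r (f k) ≤ r' k) :
    IsWeighted γ r' fun k => X (f k) := by
  intro v
  obtain ⟨C, hC⟩ := hX v
  refine ⟨|C|, fun k => (hC (f k)).trans ?_⟩
  exact mul_le_mul (le_abs_self C) (Real.rpow_le_rpow (hr k) (h k) (weight_nonneg hγ v))
    (Real.rpow_nonneg (hr k) _) (abs_nonneg C)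

theorem add (hX : IsWeighted γ r X) (hY : IsWeighted γ r Y) :
    IsWeighted γ r fun i => X i + Y i := by
  intro v
  obtain ⟨C, hC⟩ := hX v
  obtain ⟨C', hC'⟩ := hY v
  refine ⟨C + C', fun i => ?_⟩
  rw [add_mul]
  exact (abs_add_le _ _).trans (add_le_add (hC i) (hC' i))

theorem neg (hX : IsWeighted γ r X) : IsWeighted γ r fun i => -X i := by
  intro v
  obtain ⟨C, hC⟩ := hX v
  exact ⟨C, fun i => (abs_neg (X i v)).trans_le (hC i)⟩

theorem sub (hX : IsWeighted γ r X) (hY : IsWeighted γ r Y) :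
    IsWeighted γ r fun i => X i - Y i := by
  simp only [sub_eq_add_neg]
  exact hX.add hY.neg

theorem one (γ : A → ℝ) (r : ι → ℝ) : IsWeighted γ r fun _ => 1 := by
  intro v
  cases v with
  | nil => exact ⟨1, fun i => by simp [weight]⟩
  | cons a v => exact ⟨0, fun i => by simp⟩

theorem mul (hγ : ∀ a, 0 < γ a) (hr : ∀ i, 0 ≤ r i) (hX : IsWeighted γ r X)
    (hY : IsWeighted γ r Y) : IsWeighted γ r fun i => X i * Y i := by
  intro v
  choose C hC using hX
  choose C' hC' using hY
  refine ⟨∑ k ∈ Finset.range (v.length + 1), C (v.take k) * C' (v.drop k), fun i => ?_⟩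
  change |(X i * Y i) v| ≤ _
  rw [Ser.mul_apply, Finset.sum_mul]
  refine (Finset.abs_sum_le_sum_abs _ _).trans (Finset.sum_le_sum fun k _ => ?_)
  have hw : weight γ v = weight γ (v.take k) + weight γ (v.drop k) := by
    rw [← weight_append, List.take_append_drop]
  rw [hw, Real.rpow_add_of_nonneg (hr i) (weight_nonneg hγ _) (weight_nonneg hγ _), abs_mul]
  refine (mul_le_mul (hC _ i) (hC' _ i) (abs_nonneg _) ((abs_nonneg _).trans (hC _ i))).trans
    (le_of_eq (by ring))

theorem pow (hγ : ∀ a, 0 < γ a) (hr : ∀ i, 0 ≤ r i) (hX : IsWeighted γ r X) (k : ℕ) :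
    IsWeighted γ r fun i => X i ^ k := by
  induction k with
  | zero => simpa only [pow_zero] using one γ r
  | succ k ih => simpa only [pow_succ] using ih.mul hγ hr hX

theorem log (hγ : ∀ a, 0 < γ a) (hr : ∀ i, 0 ≤ r i) (hX : IsWeighted γ r X) :
    IsWeighted γ r fun i => (X i).log := by
  intro v
  have h : ∀ k : ℕ, ∃ C : ℝ, ∀ i, |((X i - 1) ^ k) v| ≤ C * r i ^ weight γ v := fun k =>
    (hX.sub (one γ r)).pow hγ hr k v
  choose C hC using h
  refine ⟨∑ k ∈ Finset.Icc 1 v.length, C k / k, fun i => ?_⟩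
  change |∑ k ∈ Finset.Icc 1 v.length, (-1 : ℝ) ^ (k + 1) * ((X i - 1) ^ k) v / (k : ℝ)| ≤ _
  rw [Finset.sum_mul]
  refine (Finset.abs_sum_le_sum_abs _ _).trans (Finset.sum_le_sum fun k _ => ?_)
  rw [abs_div, abs_mul, abs_pow, abs_neg, abs_one, one_pow, one_mul, Nat.abs_cast,
    div_mul_eq_mul_div]
  exact div_le_div_of_nonneg_right (hC k i) (Nat.cast_nonneg k)

theorem sh (hX : IsWeighted γ r X) (u v : List A) :
    ∃ C : ℝ, ∀ i, |(X i).sh u v| ≤ C * r i ^ weight γ (u ++ v) := by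
  have h : ∀ l : List (List A), (∀ w ∈ l, w.Perm (u ++ v)) →
      ∃ C : ℝ, ∀ i, |(l.map fun w => X i w).sum| ≤ C * r i ^ weight γ (u ++ v) := by
    intro l
    induction l with
    | nil => exact fun _ => ⟨0, fun i => by simp⟩
    | cons w l ih =>
      intro hl
      obtain ⟨C, hC⟩ := ih fun w' hw' => hl w' (List.mem_cons_of_mem _ hw')
      obtain ⟨C', hC'⟩ := hX w
      rw [weight_perm γ (hl w List.mem_cons_self)] at hC'
      refine ⟨C' + C, fun i => ?_⟩
      rw [List.map_cons, List.sum_cons, add_mul]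
      exact (abs_add_le _ _).trans (add_le_add (hC' i) (hC i))
  exact h _ fun w hw => perm_of_mem_shuffle hw

end IsWeighted

/-! ### Partial lifts and the extension by one letter -/

/-- A rough path over `x` on the admissible words of length at most `n`, dyadically normalized,
which vanishes on all other words. -/
structure IsPartialLift (γ : A → ℝ) (x : A → I → ℝ) (n : ℕ) (X : I → I → Ser A) : Prop where
  nil : ∀ s t, X s t [] = 1
  letter : ∀ a s t, X s t [a] = x a t - x a s
  support : ∀ s t v, ¬(v ∈ admissible γ ∧ v.length ≤ n) → X s t v = 0
  chen : ∀ v ∈ admissible γ, v.length ≤ n → ∀ s u t, (X s u * X u t) v = X s t v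
  bound : IsWeighted γ (fun p : I × I => |(p.2 : ℝ) - p.1|) fun p => X p.1 p.2
  char : ∀ u v, u ++ v ∈ admissible γ → (u ++ v).length ≤ n → ∀ s t, (X s t).defect u v = 0
  whole : ∀ v ∈ admissible γ, v.length ≤ n → 2 ≤ v.length → (X 0 1).log v = 0
  halves : ∀ v ∈ admissible γ, v.length ≤ n → 2 ≤ v.length → ∀ (m k : ℕ) (s u t : I),
    (s : ℝ) = k / 2 ^ m → (u : ℝ) = (2 * k + 1) / 2 ^ (m + 1) → (t : ℝ) = (k + 1) / 2 ^ m →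
    (X s u).log v = (X u t).log v

theorem isPartialLift_one {γ : A → ℝ} (hγ : ∀ a, 0 < γ a ∧ γ a < 1) {x : A → I → ℝ}
    (hx : ∀ a, ∃ C : ℝ, ∀ s t : I, |x a t - x a s| ≤ C * |(t : ℝ) - s| ^ γ a) :
    ∃ X, IsPartialLift γ x 1 X := by
  let X : I → I → Ser A := fun s t v =>
    match v with
    | [] => 1
    | [a] => x a t - x a s
    | _ :: _ :: _ => 0
  have hnil : ∀ s t, X s t [] = 1 := fun _ _ => rfl
  have hletter : ∀ a s t, X s t [a] = x a t - x a s := fun _ _ _ => rfl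
  refine ⟨X, hnil, hletter, ?_, ?_, ?_, ?_, ?_, ?_⟩
  · intro s t v hv
    match v with
    | [] => simp [admissible, weight] at hv
    | [a] => exact absurd ⟨by simpa [admissible, weight] using (hγ a).2.le, le_rfl⟩ hv
    | _ :: _ :: _ => rfl
  · intro v _ hl s u t
    match v with
    | [] => simp [hnil]
    | [a] =>
      rw [Ser.mul_apply]
      simp [Finset.sum_range_succ, hnil, hletter]
    | a :: b :: v => simp at hl
  · intro v
    match v with
    | [] => exact ⟨1, fun p => by simp [hnil, weight]⟩
    | [a] =>
      obtain ⟨C, hC⟩ := hx a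
      exact ⟨C, fun p => by simpa [weight, hletter] using hC p.1 p.2⟩
    | _ :: _ :: _ => exact ⟨0, fun p => by simp [X]⟩
  · intro u v _ hl s t
    match u, v with
    | [], v => exact Ser.defect_nil_left (hnil s t) v
    | u, [] => exact Ser.defect_nil_right (hnil s t) u
    | a :: u, b :: v =>
      simp at hl
  · intro v _ h1 h2
    omega
  · intro v _ h1 h2
    omega

namespace IsPartialLift

variable {γ : A → ℝ} {x : A → I → ℝ} {n : ℕ} {X : I → I → Ser A}

/-- Evaluate the triple product `X 0 s * X s u * X u t` at `v` with both bracketings. Chen's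
relation on shorter words collapses the inner product except at `v` itself, where `X` is zero. -/
theorem cocycle (hγ : ∀ a, 0 < γ a) (h : IsPartialLift γ x n X) {v : List A}
    (hv : v ∈ admissible γ) (hl : v.length = n + 1) (s u t : I) :
    (X 0 s * X s t) v - (X 0 s * X s u) v - (X 0 u * X u t) v = -(X s u * X u t) v := by
  have hz : ∀ s t, X s t v = 0 := fun s t => h.support s t v fun hh => by omega
  have h1 : ((X 0 s * X s u) * X u t) v = (X 0 u * X u t) v + (X 0 s * X s u) v := by
    have := Ser.mul_apply_of_take_vanish (X := X 0 s * X s u - X 0 u) (v := v) (fun i hi => by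
      rw [Ser.sub_apply, h.chen _ (admissible_of_sublist hγ (List.take_sublist i v) hv)
        (by rw [List.length_take]; omega), sub_self]) (X u t)
    rw [sub_mul, Ser.sub_apply, Ser.sub_apply, hz 0 u, h.nil] at this
    linarith
  have h2 : (X 0 s * (X s u * X u t)) v = (X 0 s * X s t) v + (X s u * X u t) v := by
    have := Ser.mul_apply_of_drop_vanish (X 0 s) (Y := X s u * X u t - X s t) (v := v)
      (fun i hi hi' => by
      rw [Ser.sub_apply, h.chen _ (admissible_of_sublist hγ (List.drop_sublist i v) hv)
        (by rw [List.length_drop]; omega), sub_self])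
    rw [mul_sub, Ser.sub_apply, Ser.sub_apply, hz s t, h.nil] at this
    linarith
  rw [mul_assoc] at h1
  linarith

theorem exists_path (hγ : ∀ a, 0 < γ a) (hw : ∀ v ∈ admissible γ, weight γ v < 1)
    (h : IsPartialLift γ x n X) {v : List A}
    (hv : v ∈ admissible γ) (hl : v.length = n + 1) :
    ∃ (F : I → ℝ) (K : ℝ), F 1 - F 0 - ((X 0 0 * X 0 1) v - (X 0 1).log v) = 0 ∧
      (∀ (m k : ℕ) (s u t : I), (s : ℝ) = k / 2 ^ m → (u : ℝ) = (2 * k + 1) / 2 ^ (m + 1) →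
        (t : ℝ) = (k + 1) / 2 ^ m → F u - F s - ((X 0 s * X s u) v - (X s u).log v)
          = F t - F u - ((X 0 u * X u t) v - (X u t).log v)) ∧
      ∀ s t : I, |F t - F s - ((X 0 s * X s t) v - (X s t).log v)| ≤
        K * |(t : ℝ) - s| ^ weight γ v := by
  have hpos : 0 < weight γ v := weight_pos hγ (by rintro rfl; simp at hl)
  -- Triples of times together with a scale `r` dominating their distances: a single weighted family
  -- over this set gives a constant uniform in `s`, `u`, `t` and `r`.
  let ι := {q : (I × I × I) × ℝ // |(q.1.2.1 : ℝ) - q.1.1| ≤ q.2 ∧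
    |(q.1.2.2 : ℝ) - q.1.2.1| ≤ q.2 ∧ |(q.1.2.2 : ℝ) - q.1.1| ≤ q.2}
  have hlog := h.bound.log hγ fun p => abs_nonneg _
  have b1 : IsWeighted γ (fun q : ι => q.1.2) fun q => X q.1.1.1 q.1.1.2.1 :=
    h.bound.comp hγ (fun q : ι => (q.1.1.1, q.1.1.2.1)) (fun q => abs_nonneg _) fun q => q.2.1
  have b2 : IsWeighted γ (fun q : ι => q.1.2) fun q => X q.1.1.2.1 q.1.1.2.2 :=
    h.bound.comp hγ (fun q : ι => (q.1.1.2.1, q.1.1.2.2)) (fun q => abs_nonneg _)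
      fun q => q.2.2.1
  have l1 : IsWeighted γ (fun q : ι => q.1.2) fun q => (X q.1.1.1 q.1.1.2.1).log :=
    hlog.comp hγ (fun q : ι => (q.1.1.1, q.1.1.2.1)) (fun q => abs_nonneg _) fun q => q.2.1
  have l2 : IsWeighted γ (fun q : ι => q.1.2) fun q => (X q.1.1.2.1 q.1.1.2.2).log :=
    hlog.comp hγ (fun q : ι => (q.1.1.2.1, q.1.1.2.2)) (fun q => abs_nonneg _) fun q => q.2.2.1
  have l3 : IsWeighted γ (fun q : ι => q.1.2) fun q => (X q.1.1.1 q.1.1.2.2).log :=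
    hlog.comp hγ (fun q : ι => (q.1.1.1, q.1.1.2.2)) (fun q => abs_nonneg _) fun q => q.2.2.2
  obtain ⟨C, hC⟩ := ((((b1.mul hγ (fun q => (abs_nonneg _).trans q.2.1) b2).add l3).sub
    l1).sub l2) v
  refine exists_dyadic_path_unitInterval (C := C)
    (b := fun s t => (X 0 s * X s t) v - (X s t).log v) hpos (hw v hv) fun s u t r h1 h2 h3 => ?_
  have := hC ⟨((s, u, t), r), h1, h2, h3⟩
  simp only [Ser.add_apply, Ser.sub_apply] at this
  rw [← abs_neg] at this
  refine le_of_eq_of_le (congrArg _ ?_) this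
  linarith [h.cocycle hγ hv hl s u t]

theorem succ (hγ : ∀ a, 0 < γ a) (hw : ∀ v ∈ admissible γ, weight γ v < 1) (hn : 1 ≤ n)
    (h : IsPartialLift γ x n X) : ∃ X', IsPartialLift γ x (n + 1) X' := by
  classical
  have hex : ∀ v : List A, ∃ (F : I → ℝ) (K : ℝ), v ∈ admissible γ → v.length = n + 1 →
      F 1 - F 0 - ((X 0 0 * X 0 1) v - (X 0 1).log v) = 0 ∧
      (∀ (m k : ℕ) (s u t : I), (s : ℝ) = k / 2 ^ m → (u : ℝ) = (2 * k + 1) / 2 ^ (m + 1) →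
        (t : ℝ) = (k + 1) / 2 ^ m → F u - F s - ((X 0 s * X s u) v - (X s u).log v)
          = F t - F u - ((X 0 u * X u t) v - (X u t).log v)) ∧
      ∀ s t : I, |F t - F s - ((X 0 s * X s t) v - (X s t).log v)| ≤
        K * |(t : ℝ) - s| ^ weight γ v := by
    intro v
    by_cases hv : v ∈ admissible γ ∧ v.length = n + 1
    · obtain ⟨F, K, hF⟩ := h.exists_path hγ hw hv.1 hv.2
      exact ⟨F, K, fun _ _ => hF⟩
    · exact ⟨0, 0, fun h1 h2 => absurd ⟨h1, h2⟩ hv⟩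
  choose F K hF using hex
  -- Chen's relation holds at the new level for every choice of `F`; the choice matters for the
  -- bound, the normalization and, through them, the shuffle identities.
  let τ : I → I → Ser A := fun s t v =>
    if v ∈ admissible γ ∧ v.length = n + 1 then F v t - F v s - (X 0 s * X s t) v else 0
  have hτ0 : ∀ s t v, v.length < n + 1 → τ s t v = 0 := fun s t v hv =>
    if_neg fun hh => by omega
  have hτ : ∀ s t v, v ∈ admissible γ → v.length = n + 1 →
      τ s t v = F v t - F v s - (X 0 s * X s t) v := fun s t v h1 h2 => if_pos ⟨h1, h2⟩
  have hX0 : ∀ s t v, v.length = n + 1 → X s t v = 0 := fun s t v hv =>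
    h.support s t v fun hh => by omega
  let X' : I → I → Ser A := fun s t => X s t + τ s t
  have hlow : ∀ s t v, v.length < n + 1 → X' s t v = X s t v := fun s t v hv => by
    simp only [X', Ser.add_apply, hτ0 s t v hv, add_zero]
  have hnil : ∀ s t, X' s t [] = 1 := fun s t => by rw [hlow s t [] (by simp), h.nil]
  have hlog : ∀ s t v, v.length ≤ n + 1 → (X' s t).log v = (X s t).log v + τ s t v :=
    fun s t v hv => Ser.log_add_apply (h.nil s t) (hτ0 s t) (Nat.succ_pos n) hv
  have hchen : ∀ v ∈ admissible γ, v.length ≤ n + 1 →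
      ∀ s u t, (X' s u * X' u t) v = X' s t v := by
    intro v hv hl s u t
    rw [Ser.add_mul_add_apply _ _ (hτ0 s u) (hτ0 u t) (Nat.succ_pos n) hl, h.nil, h.nil,
      show X' s t v = X s t v + τ s t v from rfl]
    rcases hl.lt_or_eq with hl | hl
    · rw [hτ0 s u v hl, hτ0 u t v hl, hτ0 s t v hl, h.chen v hv (by omega)]
      ring
    · rw [hτ s u v hv hl, hτ u t v hv hl, hτ s t v hv hl, hX0 s t v hl]
      linarith [h.cocycle hγ hv hl s u t]
  have hbound : IsWeighted γ (fun p : I × I => |(p.2 : ℝ) - p.1|) fun p => X' p.1 p.2 := by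
    refine h.bound.add fun v => ?_
    by_cases hv : v ∈ admissible γ ∧ v.length = n + 1
    · obtain ⟨C, hC⟩ := (h.bound.log hγ fun p => abs_nonneg _) v
      refine ⟨K v + C, fun p => ?_⟩
      rw [hτ _ _ v hv.1 hv.2, add_mul]
      have h1 := (hF v hv.1 hv.2).2.2 p.1 p.2
      have h2 := hC p
      have h3 : F v p.2 - F v p.1 - (X 0 p.1 * X p.1 p.2) v =
          (F v p.2 - F v p.1 - ((X 0 p.1 * X p.1 p.2) v - (X p.1 p.2).log v))
            - (X p.1 p.2).log v := by ring
      rw [h3]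
      exact (abs_sub _ _).trans (add_le_add h1 h2)
    · exact ⟨0, fun p => by simp [τ, hv]⟩
  have hwhole : ∀ v ∈ admissible γ, v.length ≤ n + 1 → 2 ≤ v.length → (X' 0 1).log v = 0 := by
    intro v hv hl h2
    rw [hlog 0 1 v hl]
    rcases hl.lt_or_eq with hl | hl
    · rw [hτ0 0 1 v hl, h.whole v hv (by omega) h2, add_zero]
    · rw [hτ 0 1 v hv hl]
      linarith [(hF v hv hl).1]
  have hhalves : ∀ v ∈ admissible γ, v.length ≤ n + 1 → 2 ≤ v.length →
      ∀ (m k : ℕ) (s u t : I), (s : ℝ) = k / 2 ^ m → (u : ℝ) = (2 * k + 1) / 2 ^ (m + 1) →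
        (t : ℝ) = (k + 1) / 2 ^ m → (X' s u).log v = (X' u t).log v := by
    intro v hv hl h2 m k s u t hs hu ht
    rw [hlog s u v hl, hlog u t v hl]
    rcases hl.lt_or_eq with hl | hl
    · rw [hτ0 s u v hl, hτ0 u t v hl, h.halves v hv (by omega) h2 m k s u t hs hu ht]
    · rw [hτ s u v hv hl, hτ u t v hv hl]
      linarith [(hF v hv hl).2.1 m k s u t hs hu ht]
  have hcharlow : ∀ u v, u ++ v ∈ admissible γ → (u ++ v).length ≤ n →
      ∀ s t, (X' s t).defect u v = 0 := by
    intro u v huv hl s t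
    have hl' := hl
    rw [List.length_append] at hl'
    rw [← h.char u v huv hl s t, Ser.defect, Ser.defect, hlow s t u (by omega),
      hlow s t v (by omega),
      Ser.sh_congr fun w hw => hlow s t w (by rw [hw.length_eq]; omega)]
  refine ⟨X', hnil, ?_, ?_, hchen, hbound, ?_, hwhole, hhalves⟩
  · intro a s t
    rw [hlow s t [a] (by simp; omega), h.letter]
  · intro s t v hv
    simp only [X', Ser.add_apply]
    rw [h.support s t v fun hh => hv ⟨hh.1, by omega⟩, zero_add]
    exact if_neg fun hh => hv ⟨hh.1, by omega⟩
  · intro u v huv hl s t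
    rcases eq_or_ne u [] with rfl | hu
    · exact Ser.defect_nil_left (hnil s t) v
    rcases eq_or_ne v [] with rfl | hv
    · exact Ser.defect_nil_right (hnil s t) u
    rcases hl.lt_or_eq with hl | hl
    · exact hcharlow u v huv (by omega) s t
    have hprop : ∀ s t, (X' s t).ProperChar u v := fun s t u' v' hu' hv' hlt =>
      hcharlow u' v' (admissible_of_sublist hγ (hu'.append hv') huv)
        (by rw [List.length_append] at hl ⊢; omega) s t
    have hperm : ∀ w : List A, w.Perm (u ++ v) → w ∈ admissible γ ∧ w.length = n + 1 :=
      fun w hw' => ⟨(weight_perm γ hw').trans_le huv, hw'.length_eq.trans hl⟩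
    have hD : ∀ s t, (X' s t).defect u v = (X' s t).log.sh u v := fun s t =>
      (Ser.sh_log (hnil s t) hu hv (hprop s t)).symm
    have hpos : 0 < weight γ (u ++ v) := weight_pos hγ (by simp [hu])
    obtain ⟨C, hC⟩ := (hbound.log hγ fun p => abs_nonneg _).sh u v
    -- Additivity comes from Chen's relation. The other three conditions are read off the logarithm,
    -- since every word of the shuffle is admissible of length `n + 1 ≥ 2`.
    refine eq_zero_of_additive_of_dyadic (D := fun s t => (X' s t).defect u v) (C := C) hpos
      ?_ ?_ ?_ ?_ s t
    · intro s r t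
      rw [← Ser.defect_mul (hnil s r) (hnil r t) (hprop s r) (hprop r t), Ser.defect, Ser.defect,
        hchen u (admissible_of_sublist hγ (List.sublist_append_left u v) huv)
          (by rw [List.length_append] at hl; omega),
        hchen v (admissible_of_sublist hγ (List.sublist_append_right u v) huv)
          (by rw [List.length_append] at hl; omega),
        Ser.sh_congr fun w hw' => hchen w (hperm w hw').1 (hperm w hw').2.le s r t]
    · simp only [hD]
      refine (Ser.sh_congr (Y := 0) fun w hw' => ?_).trans (by simp [Ser.sh])
      obtain ⟨h1, h2⟩ := hperm w hw'
      exact hwhole w h1 h2.le (by omega)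
    · intro m k s r t hs hr ht
      simp only [hD]
      refine Ser.sh_congr fun w hw' => ?_
      obtain ⟨h1, h2⟩ := hperm w hw'
      exact hhalves w h1 h2.le (by omega) m k s r t hs hr ht
    · intro s t
      simp only [hD]
      exact hC (s, t)

theorem exists_of_one_le (hγ : ∀ a, 0 < γ a ∧ γ a < 1)
    (hw : ∀ v ∈ admissible γ, weight γ v < 1)
    (hx : ∀ a, ∃ C : ℝ, ∀ s t : I, |x a t - x a s| ≤ C * |(t : ℝ) - s| ^ γ a) (hn : 1 ≤ n) :
    ∃ X, IsPartialLift γ x n X := by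
  induction n, hn using Nat.le_induction with
  | base => exact isPartialLift_one hγ hx
  | succ n hn ih =>
    obtain ⟨X, hX⟩ := ih
    exact hX.succ (fun a => (hγ a).1) hw hn

end IsPartialLift

/-! ### From partial lifts to rough paths; uniqueness -/

theorem exists_length_le [Finite A] {γ : A → ℝ} (hγ : ∀ a, 0 < γ a) :
    ∃ N : ℕ, 1 ≤ N ∧ ∀ v ∈ admissible γ, v.length ≤ N := by
  obtain ⟨c, hc, hcγ⟩ : ∃ c : ℝ, 0 < c ∧ ∀ a, c ≤ γ a := by
    cases isEmpty_or_nonempty A with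
    | inl h => exact ⟨1, one_pos, fun a => h.elim a⟩
    | inr h =>
      obtain ⟨a, ha⟩ := Finite.exists_min γ
      exact ⟨γ a, hγ a, ha⟩
  have hlen : ∀ v : List A, v.length * c ≤ weight γ v := by
    intro v
    induction v with
    | nil => simp [weight]
    | cons a v ih =>
      have := hcγ a
      simp only [weight, List.map_cons, List.sum_cons, List.length_cons] at ih ⊢
      push_cast
      linarith
  obtain ⟨N, hN⟩ := exists_nat_ge (1 / c)
  refine ⟨N + 1, by omega, fun v hv => ?_⟩
  have h1 : (v.length : ℝ) ≤ 1 / c := by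
    rw [le_div_iff₀ hc]
    exact (hlen v).trans hv
  have h2 : v.length ≤ N := by exact_mod_cast h1.trans hN
  omega

/-- A weight is the combination of the `γ a` with the letter counts as coefficients, so
non-resonance excludes the critical exponent `1`. -/
theorem weight_lt_one [Fintype A] {γ : A → ℝ} (hres : ∀ n : A → ℕ, ∑ a, (n a : ℝ) * γ a ≠ 1)
    {v : List A} (hv : v ∈ admissible γ) : weight γ v < 1 := by
  classical
  refine lt_of_le_of_ne hv fun h => ?_
  have hcount : ∀ w : List A, ∃ n : A → ℕ, ∑ a, (n a : ℝ) * γ a = weight γ w := by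
    intro w
    induction w with
    | nil => exact ⟨0, by simp [weight]⟩
    | cons b w ih =>
      obtain ⟨n, hn⟩ := ih
      refine ⟨fun a => n a + if a = b then 1 else 0, ?_⟩
      simp only [weight, List.map_cons, List.sum_cons] at hn ⊢
      push_cast
      simp only [add_mul, Finset.sum_add_distrib, hn]
      simp [add_comm]
  obtain ⟨n, hn⟩ := hcount v
  exact hres n (hn.trans h)

theorem expo_congr {γ : A → ℝ} (hγ : ∀ a, 0 < γ a) {α β : Ser A}
    (h : ∀ v ∈ admissible γ, α v = β v) {v : List A} (hv : v ∈ admissible γ) :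
    Ser.exp α v = Ser.exp β v := by
  have hpow : ∀ (k : ℕ), ∀ w ∈ admissible γ, (α ^ k) w = (β ^ k) w := by
    intro k
    induction k with
    | zero => exact fun _ _ => rfl
    | succ k ih =>
      intro w hw
      rw [pow_succ, pow_succ]
      exact Ser.mul_apply_congr
        (fun i => ih _ (admissible_of_sublist hγ (List.take_sublist i w) hw))
        fun i => h _ (admissible_of_sublist hγ (List.drop_sublist i w) hw)
  exact Finset.sum_congr rfl fun k _ => by rw [hpow k v hv]

theorem logo_of_not_admissible {γ : A → ℝ} (X : Functional A) {v : List A}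
    (hv : v ∉ admissible γ) : logo γ X v = 0 :=
  Finset.sum_eq_zero fun k _ => by rw [convPow_of_not_admissible _ k hv, mul_zero, zero_div]

/-- The logarithm is the witness: `Ser.sh_log` makes it an infinitesimal character and `Ser.exp_log`
recovers `X`. -/
theorem mem_group_of_char {γ : A → ℝ} (hγ : ∀ a, 0 < γ a) {X : Ser A} (hX : X [] = 1)
    (hsupp : ∀ v, v ∉ admissible γ → X v = 0)
    (hchar : ∀ u v, u ++ v ∈ admissible γ → X.defect u v = 0) : (X : Functional A) ∈ group γ := by
  refine ⟨logo γ X, ⟨fun v hv => logo_of_not_admissible X hv, fun u v huv => ?_⟩, ?_⟩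
  · have hnil : logo γ X [] = 0 := rfl
    rcases eq_or_ne u [] with rfl | hu
    · simp [shuffle, hnil, counit]
    rcases eq_or_ne v [] with rfl | hv
    · have : ((shuffle u []).map (logo γ X)).sum = logo γ X u :=
        Ser.sh_nil_right (logo γ X : Ser A) u
      rw [this, hnil]
      simp [counit]
    have h1 : (shuffle u v).map (logo γ X) = (shuffle u v).map fun w => X.log w :=
      List.map_congr_left fun w hw => logo_apply hγ X
        ((weight_perm γ (perm_of_mem_shuffle hw)).trans_le huv)
    have h2 := Ser.sh_log hX hu hv fun u' v' hu' hv' _ =>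
      hchar u' v' (admissible_of_sublist hγ (hu'.append hv') huv)
    rw [hchar u v huv, Ser.sh] at h2
    rw [h1, h2, ← Ser.one_apply, ← Ser.one_apply, Ser.one_of_ne_nil hu, Ser.one_of_ne_nil hv]
    ring
  · funext v
    by_cases hv : v ∈ admissible γ
    · rw [expo_apply hγ (logo γ X : Ser A) hv,
        expo_congr hγ (β := X.log) (fun w hw => logo_apply hγ X hw) hv, Ser.exp_log hX]
    · rw [expo_of_not_admissible _ hv, hsupp v hv]

theorem group_nil {γ : A → ℝ} {X : Functional A} (hX : X ∈ group γ) : X [] = 1 := by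
  obtain ⟨α, -, rfl⟩ := hX
  simp [expo, convPow, counit]

theorem group_of_not_admissible {γ : A → ℝ} {X : Functional A} (hX : X ∈ group γ) {v : List A}
    (hv : v ∉ admissible γ) : X v = 0 := by
  obtain ⟨α, -, rfl⟩ := hX
  exact expo_of_not_admissible α hv

theorem IsPartialLift.isAGRP {γ : A → ℝ} (hγ : ∀ a, 0 < γ a) {x : A → I → ℝ} {n : ℕ}
    (hn : ∀ v ∈ admissible γ, v.length ≤ n) {X : I → I → Ser A} (h : IsPartialLift γ x n X) :
    IsAGRP γ X where
  mem_group s t := mem_group_of_char hγ (h.nil s t)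
    (fun v hv => h.support s t v fun hh => hv hh.1)
    fun u v huv => h.char u v huv (hn _ huv) s t
  diag t := by
    funext v
    rcases eq_or_ne v [] with rfl | hv
    · exact h.nil t t
    · obtain ⟨C, hC⟩ := h.bound v
      have : |X t t v| ≤ C * |(t : ℝ) - t| ^ weight γ v := hC (t, t)
      rw [sub_self, abs_zero, Real.zero_rpow (weight_pos hγ hv).ne', mul_zero,
        abs_nonpos_iff] at this
      exact this.trans (Ser.one_of_ne_nil hv).symm
  chen s u t := by
    funext v
    by_cases hv : v ∈ admissible γ
    · exact (conv_apply hv _ _).trans (h.chen v hv (hn v hv) s u t)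
    · exact (Set.indicator_of_notMem hv _).trans (h.support s t v fun hh => hv hh.1).symm
  bound v _ := by
    obtain ⟨C, hC⟩ := h.bound v
    exact ⟨C, fun s t => hC (s, t)⟩

theorem IsPartialLift.isDyadicallyNormalized {γ : A → ℝ} (hγ : ∀ a, 0 < γ a) {x : A → I → ℝ}
    {n : ℕ} (hn : ∀ v ∈ admissible γ, v.length ≤ n) {X : I → I → Ser A}
    (h : IsPartialLift γ x n X) : IsDyadicallyNormalized γ X where
  whole v hv h2 := (logo_apply hγ _ hv).trans (h.whole v hv (hn v hv) h2)
  halves v hv h2 m k s u t hs hu ht := (logo_apply hγ _ hv).trans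
    ((h.halves v hv (hn v hv) h2 m k s u t hs hu ht).trans (logo_apply hγ _ hv).symm)

theorem IsHolderFamily.exists_bound {γ : A → ℝ} (hγ : ∀ a, 0 < γ a) {x : A → I → ℝ}
    (hx : IsHolderFamily γ x) (a : A) :
    ∃ C : ℝ, ∀ s t : I, |x a t - x a s| ≤ C * |(t : ℝ) - s| ^ γ a := by
  obtain ⟨C, hC⟩ := hx a
  refine ⟨C, fun s t => ?_⟩
  have := hC.dist_le t s
  rwa [Real.coe_toNNReal _ (hγ a).le, Real.dist_eq, Subtype.dist_eq, Real.dist_eq] at this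

theorem IsAGRP.mul_apply {γ : A → ℝ} {X : I → I → Ser A} (hX : IsAGRP γ X) {v : List A}
    (hv : v ∈ admissible γ) (s u t : I) : (X s u * X u t) v = X s t v :=
  (conv_apply hv _ _).symm.trans (congrFun (hX.chen s u t) v)

/-- Dyadically normalized rough paths over paths with the same increments coincide. -/
theorem IsDyadicallyNormalized.unique {γ : A → ℝ} (hγ : ∀ a, 0 < γ a) {x : A → I → ℝ}
    {X Y : I → I → Ser A} (hX : IsAGRP γ X) (hY : IsAGRP γ Y) (hXx : IsOver X x)
    (hYx : IsOver Y x) (hXd : IsDyadicallyNormalized γ X) (hYd : IsDyadicallyNormalized γ Y) :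
    X = Y := by
  have main : ∀ (n : ℕ) (v : List A), v.length < n → ∀ s t, X s t v = Y s t v := by
    intro n
    induction n with
    | zero => intro v hv; omega
    | succ n ih =>
      intro v hv s t
      by_cases hva : v ∈ admissible γ
      swap
      · rw [group_of_not_admissible (hX.mem_group s t) hva,
          group_of_not_admissible (hY.mem_group s t) hva]
      rcases Nat.lt_or_ge v.length n with hlt | hge
      · exact ih v hlt s t
      have hln : v.length = n := by omega
      match v, hln with
      | [], _ => rw [group_nil (hX.mem_group s t), group_nil (hY.mem_group s t)]
      | [a], _ => rw [hXx, hYx]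
      | a :: b :: w, hln =>
      have hl2 : 2 ≤ (a :: b :: w).length := by simp
      have hn : 0 < n := by omega
      generalize a :: b :: w = v at *
      have hne : v ≠ [] := by rintro rfl; simp at hl2
      -- As `X` and `Y` agree on shorter words, the difference of their logarithms at `v` is the
      -- difference of their values, which therefore inherits the normalization.
      have hdiff : ∀ s t, logo γ (X s t) v = logo γ (Y s t) v + (X s t v - Y s t v) := by
        intro s t
        rw [logo_apply hγ (X s t : Ser A) hva, logo_apply hγ (Y s t : Ser A) hva]
        exact Ser.log_congr (X := (Y s t : Ser A)) (Y := (X s t : Ser A))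
          (group_nil (hY.mem_group s t)) (fun w hw => ih w hw s t) hn hln.le
      obtain ⟨C, hC⟩ := hX.bound v hva
      obtain ⟨C', hC'⟩ := hY.bound v hva
      refine sub_eq_zero.1 (eq_zero_of_additive_of_dyadic (D := fun s t => X s t v - Y s t v)
        (C := C + C') (weight_pos hγ hne) ?_ ?_ ?_ ?_ s t)
      · intro s r t
        -- Expand Chen's relation for `X = Y + (X - Y)`: at the first length where the difference
        -- can be nonzero, it is additive.
        have h3 := Ser.add_mul_add_apply (n := n) (Y s r) (Y r t)
          (ρ := X s r - Y s r) (τ := X r t - Y r t)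
          (fun w hw => sub_eq_zero.2 (ih w hw s r)) (fun w hw => sub_eq_zero.2 (ih w hw r t))
          hn hln.le
        rw [add_sub_cancel, add_sub_cancel, hX.mul_apply hva, hY.mul_apply hva,
          group_nil (hY.mem_group s r),
          group_nil (hY.mem_group r t), Ser.sub_apply, Ser.sub_apply] at h3
        linarith
      · have h1 := hdiff 0 1
        rw [hXd.whole v hva hl2, hYd.whole v hva hl2] at h1
        linarith
      · intro m k s r t hs hr ht
        have h1 := hdiff s r
        have h2 := hdiff r t
        rw [hXd.halves v hva hl2 m k s r t hs hr ht,
          hYd.halves v hva hl2 m k s r t hs hr ht] at h1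
        linarith
      · intro s t
        rw [add_mul]
        exact (abs_sub _ _).trans (add_le_add (hC s t) (hC' s t))
  funext s t v
  exact main (v.length + 1) v (Nat.lt_succ_self _) s t

/-! ### Existence, traces, and translation -/

theorem exists_normalized_lift [Fintype A] {γ : A → ℝ} (hγ : ∀ a, 0 < γ a ∧ γ a < 1)
    (hres : ∀ n : A → ℕ, ∑ a, (n a : ℝ) * γ a ≠ 1) {x : A → I → ℝ} (hx : IsHolderFamily γ x) :
    ∃ X, IsAGRP γ X ∧ IsOver X x ∧ IsDyadicallyNormalized γ X := by
  have hγ0 := fun a => (hγ a).1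
  obtain ⟨N, hN1, hN⟩ := exists_length_le hγ0
  obtain ⟨X, hX⟩ := IsPartialLift.exists_of_one_le hγ (fun v hv => weight_lt_one hres hv)
    (hx.exists_bound hγ0) hN1
  exact ⟨X, hX.isAGRP hγ0 hN, hX.letter, hX.isDyadicallyNormalized hγ0 hN⟩

theorem IsAGRP.isOver_trace {γ : A → ℝ} (hγ : ∀ a, γ a < 1) {X : I → I → Functional A}
    (hX : IsAGRP γ X) : IsOver X (trace X) := by
  intro a s t
  have ha : [a] ∈ admissible γ := by simpa [admissible, weight] using (hγ a).le
  have h1 := (Ser.mul_apply (X 0 s) (X s t) [a]).symm.trans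
    (IsAGRP.mul_apply (X := X) hX ha 0 s t)
  simp only [List.length_singleton, Finset.sum_range_succ, Finset.range_zero, Finset.sum_empty,
    List.take_zero, List.drop_zero, List.take_succ_cons, List.drop_succ_cons, zero_add] at h1
  rw [group_nil (hX.mem_group 0 s), group_nil (hX.mem_group s t)] at h1
  rw [trace, trace]
  linarith

theorem IsAGRP.isHolderFamily_trace {γ : A → ℝ} (hγ : ∀ a, 0 < γ a ∧ γ a < 1)
    {X : I → I → Functional A} (hX : IsAGRP γ X) : IsHolderFamily γ (trace X) := by
  intro a
  have ha : [a] ∈ admissible γ := by simpa [admissible, weight] using (hγ a).2.le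
  obtain ⟨C, hC⟩ := hX.bound [a] ha
  refine ⟨C.toNNReal, fun s t => ?_⟩
  have h1 := hC t s
  have hw : weight γ [a] = γ a := by simp [weight]
  rw [hX.isOver_trace (fun a => (hγ a).2), hw] at h1
  rw [edist_nndist, edist_nndist, ← ENNReal.coe_rpow_of_nonneg _ NNReal.zero_le_coe,
    ← ENNReal.coe_mul, ENNReal.coe_le_coe, ← NNReal.coe_le_coe]
  rw [NNReal.coe_mul, NNReal.coe_rpow, coe_nndist, coe_nndist, Real.coe_toNNReal _ (hγ a).1.le,
    Real.dist_eq, Subtype.dist_eq, Real.dist_eq]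
  exact h1.trans (mul_le_mul_of_nonneg_right (Real.le_coe_toNNReal C)
    (Real.rpow_nonneg (abs_nonneg _) _))

theorem IsHolderFamily.add {γ : A → ℝ} {x y : A → I → ℝ} (hx : IsHolderFamily γ x)
    (hy : IsHolderFamily γ y) : IsHolderFamily γ (x + y) :=
  fun a => (hx a).add (hy a)

end AnisoRP

end

theorem mainTheorem5 {A : Type*} [Fintype A] (γ : A → ℝ)
    (hγ : ∀ a, 0 < γ a ∧ γ a < 1)
    (hres : ∀ n : A → ℕ, ∑ a, (n a : ℝ) * γ a ≠ 1) :
    ∃ Φ : (A → I → ℝ) → I → I → AnisoRP.Functional A,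
      (∀ x : A → I → ℝ, AnisoRP.IsHolderFamily γ x →
        AnisoRP.IsAGRP γ (Φ x) ∧ AnisoRP.IsOver (Φ x) x ∧
        AnisoRP.IsDyadicallyNormalized γ (Φ x) ∧
        ∀ Y : I → I → AnisoRP.Functional A,
          AnisoRP.IsAGRP γ Y → AnisoRP.IsOver Y x →
            AnisoRP.IsDyadicallyNormalized γ Y → Y = Φ x) ∧
      (∀ (x g : A → I → ℝ) (X : I → I → AnisoRP.Functional A),
        AnisoRP.IsHolderFamily γ x → AnisoRP.IsHolderFamily γ g →
        AnisoRP.IsAGRP γ X → AnisoRP.IsOver X x →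
          AnisoRP.translate Φ g X = Φ (x + g)) ∧
      (∀ (g g' : A → I → ℝ) (X : I → I → AnisoRP.Functional A),
        AnisoRP.IsHolderFamily γ g → AnisoRP.IsHolderFamily γ g' →
        AnisoRP.IsAGRP γ X →
          AnisoRP.translate Φ g' (AnisoRP.translate Φ g X) =
            AnisoRP.translate Φ (g + g') X) := by
  classical
  have hγ0 := fun a => (hγ a).1
  have hex : ∀ x : A → I → ℝ, ∃ X : I → I → AnisoRP.Functional A,
      AnisoRP.IsHolderFamily γ x → AnisoRP.IsAGRP γ X ∧ AnisoRP.IsOver X x ∧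
        AnisoRP.IsDyadicallyNormalized γ X := by
    intro x
    by_cases hx : AnisoRP.IsHolderFamily γ x
    · obtain ⟨X, hX⟩ := AnisoRP.exists_normalized_lift hγ hres hx
      exact ⟨X, fun _ => hX⟩
    -- A default value, so that `Φ` is total; nothing is claimed about it.
    · exact ⟨0, fun h => absurd h hx⟩
  choose Φ hΦ using hex
  -- Being a lift involves only increments. This is needed because `trace X` and `x` may differ by
  -- constants.
  have hcongr : ∀ x y : A → I → ℝ, AnisoRP.IsHolderFamily γ x → AnisoRP.IsHolderFamily γ y →
      (∀ a s t, x a t - x a s = y a t - y a s) → Φ x = Φ y := by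
    intro x y hx hy hxy
    obtain ⟨h1, h2, h3⟩ := hΦ x hx
    obtain ⟨k1, k2, k3⟩ := hΦ y hy
    exact AnisoRP.IsDyadicallyNormalized.unique hγ0 h1 k1 h2
      (fun a s t => (k2 a s t).trans (hxy a s t).symm) h3 k3
  have htrans : ∀ (x g : A → I → ℝ) (X : I → I → AnisoRP.Functional A),
      AnisoRP.IsHolderFamily γ x → AnisoRP.IsHolderFamily γ g →
      AnisoRP.IsAGRP γ X → AnisoRP.IsOver X x →
        AnisoRP.translate Φ g X = Φ (x + g) := by
    intro x g X hx hg hX hXx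
    refine hcongr _ _ ((hX.isHolderFamily_trace hγ).add hg) (hx.add hg) fun a s t => ?_
    have h1 := hXx a 0 s
    have h2 := hXx a 0 t
    simp only [Pi.add_apply, AnisoRP.trace]
    linarith
  refine ⟨Φ, fun x hx => ?_, htrans, fun g g' X hg hg' hX => ?_⟩
  · obtain ⟨h1, h2, h3⟩ := hΦ x hx
    exact ⟨h1, h2, h3, fun Y hY hYx hYd =>
      AnisoRP.IsDyadicallyNormalized.unique hγ0 hY h1 hYx h2 hYd h3⟩
  · have hT := hX.isHolderFamily_trace hγ
    obtain ⟨h1, h2, -⟩ := hΦ _ (hT.add hg)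
    rw [AnisoRP.translate, AnisoRP.translate, AnisoRP.translate, ← add_assoc]
    -- The once-translated path is a rough path over `trace X + g`, so the previous identity applies
    -- with it in place of `X`.
    exact htrans _ g' _ (hT.add hg) hg' h1 h2
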